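/- Let $D\subseteq\mathbb{R}^2$ be an open connected set containing the origin, let $a_1,a_2\ge 0$, let $h:D\to\mathbb{R}$ be of class $C^2$ and vanish at the origin together with all its first and second partial derivatives, and put $f(x_1,x_2)=-\tfrac12(a_1x_1^2+a_2x_2^2)-h(x_1,x_2)$. Let $K_0=\{(x_1,x_2,f(x_1,x_2)) : (x_1,x_2)\in D\}\subset\mathbb{R}^3$, and assume that this $C^2$ surface patch is convex, that is, $f$ is the restriction to $D$ of a concave function on the convex hull of $D$. Let $\hat n$ be the upward (outward) unit normal of $K_0$, fix $r>0$, and let $K_r=\{p+r\,\hat n(p) : p\in K_0\}$ be the parallel surface at distance $r$. Let $\Pi:K_r\to K_0$ be the projection that sends a point of $K_r$ to the point of $K_0$ nearest to it. Call a curve on an open interval in a surface in $\mathbb{R}^3$ a geodesic if it is a reparametrization, by a $C^1$ change of parameter with nowhere vanishing derivative, of a $C^2$ unit speed curve in the surface whose acceleration is everywhere normal to the surface. Say that $\Pi$ preserves geodesics if $\Pi\circ\beta$ is a geodesic of $K_0$ for every geodesic $\beta$ of $K_r$. Then $\Pi$ does not preserve geodesics, unless one of the following holds: (i) the Gaussian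 curvature of $K_0$ vanishes at every point of the patch (in particular $a_1a_2=0$); or (ii) every point of the patch is umbilic (in particular $a_1=a_2$). -/

import Mathlib

noncomputable section

/-- The height function `-½ (a₁ x₁² + a₂ x₂²) - h(x₁, x₂)`; the coordinates `x₁`, `x₂` are
`x 0`, `x 1`. -/
def patchHeight (a₁ a₂ : ℝ) (h : EuclideanSpace ℝ (Fin 2) → ℝ) (x : EuclideanSpace ℝ (Fin 2)) : ℝ :=
  -(1 / 2) * (a₁ * x 0 ^ 2 + a₂ * x 1 ^ 2) - h x

/-- The `i`-th partial derivative of a real function on the plane. -/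
def partialD (i : Fin 2) (f : EuclideanSpace ℝ (Fin 2) → ℝ) (x : EuclideanSpace ℝ (Fin 2)) : ℝ :=
  fderiv ℝ f x (EuclideanSpace.single i 1)

/-- The graph parametrization `x ↦ (x₁, x₂, f x)` of the surface `z = f x`. -/
def graphMap (f : EuclideanSpace ℝ (Fin 2) → ℝ) (x : EuclideanSpace ℝ (Fin 2)) :
    EuclideanSpace ℝ (Fin 3) :=
  !₂[x 0, x 1, f x]

/-- The upward unit normal of the graph of `f` at the point over `x`. For a concave `f` it is the
normal that points out of the convex region below the graph. -/
def graphNormal (f : EuclideanSpace ℝ (Fin 2) → ℝ) (x : EuclideanSpace ℝ (Fin 2)) :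
    EuclideanSpace ℝ (Fin 3) :=
  (Real.sqrt (1 + partialD 0 f x ^ 2 + partialD 1 f x ^ 2))⁻¹ •
    !₂[-partialD 0 f x, -partialD 1 f x, 1]

/-- The parametrization `x ↦ X x + r n x` of the surface parallel to the graph of `f` at (signed)
distance `r`. -/
def parallelMap (f : EuclideanSpace ℝ (Fin 2) → ℝ) (r : ℝ) (x : EuclideanSpace ℝ (Fin 2)) :
    EuclideanSpace ℝ (Fin 3) :=
  graphMap f x + r • graphNormal f x

/-- `c`, on the open set `J` of parameters, is a unit speed geodesic of the surface parametrized by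
`X` on `D`: it is `C²`, it has speed one, it lies in the surface, and its acceleration is normal
to the surface, whose tangent plane at `X x` is the range of the differential of `X` at `x`. -/
def IsUnitSpeedGeodesic (X : EuclideanSpace ℝ (Fin 2) → EuclideanSpace ℝ (Fin 3))
    (D : Set (EuclideanSpace ℝ (Fin 2))) (J : Set ℝ) (c : ℝ → EuclideanSpace ℝ (Fin 3)) : Prop :=
  ContDiffOn ℝ 2 c J ∧
    ∀ t ∈ J, ‖deriv c t‖ = 1 ∧
      ∃ x ∈ D, c t = X x ∧
        ∀ v : EuclideanSpace ℝ (Fin 2), inner ℝ (deriv (deriv c) t) (fderiv ℝ X x v) = 0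

/-- `γ`, on the open interval `I`, is a geodesic up to parametrization: `γ = c ∘ s` on `I`, where `s`
is `C¹` with nowhere vanishing derivative and `c` is a unit speed geodesic on the interval `s(I)`,
which is again open. -/
def IsGeodesic (X : EuclideanSpace ℝ (Fin 2) → EuclideanSpace ℝ (Fin 3))
    (D : Set (EuclideanSpace ℝ (Fin 2))) (I : Set ℝ) (γ : ℝ → EuclideanSpace ℝ (Fin 3)) : Prop :=
  ∃ (s : ℝ → ℝ) (c : ℝ → EuclideanSpace ℝ (Fin 3)),
    ContDiffOn ℝ 1 s I ∧ (∀ t ∈ I, deriv s t ≠ 0) ∧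
      IsUnitSpeedGeodesic X D (s '' I) c ∧ ∀ t ∈ I, γ t = c (s t)

/-- The projection of `y` to the set `S`: all points of `S` at minimal distance from `y`. -/
def nearestPoints (S : Set (EuclideanSpace ℝ (Fin 3))) (y : EuclideanSpace ℝ (Fin 3)) :
    Set (EuclideanSpace ℝ (Fin 3)) :=
  {p | p ∈ S ∧ ∀ q ∈ S, dist y p ≤ dist y q}

/-- The nearest-point projection from the parallel surface at distance `r` to the graph of `f` over
`D` preserves geodesics: it carries every geodesic of the parallel surface, on any open interval,
to a geodesic of the graph, both up to parametrization. -/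
def ProjectionPreservesGeodesics (f : EuclideanSpace ℝ (Fin 2) → ℝ)
    (D : Set (EuclideanSpace ℝ (Fin 2))) (r : ℝ) : Prop :=
  ∀ (I : Set ℝ) (β : ℝ → EuclideanSpace ℝ (Fin 3)), IsOpen I → IsPreconnected I →
    IsGeodesic (parallelMap f r) D I β →
      ∃ γ : ℝ → EuclideanSpace ℝ (Fin 3),
        (∀ t ∈ I, nearestPoints (graphMap f '' D) (β t) = {γ t}) ∧ IsGeodesic (graphMap f) D I γ

/-- The first fundamental form `⟨dX v, dX w⟩` of the graph of `f`. -/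
def firstForm (f : EuclideanSpace ℝ (Fin 2) → ℝ) (x v w : EuclideanSpace ℝ (Fin 2)) : ℝ :=
  inner ℝ (fderiv ℝ (graphMap f) x v) (fderiv ℝ (graphMap f) x w)

/-- The second fundamental form `⟨dn v, dX w⟩` of the graph of `f`, with the sign for which it is
positive semidefinite when `f` is concave. -/
def secondForm (f : EuclideanSpace ℝ (Fin 2) → ℝ) (x v w : EuclideanSpace ℝ (Fin 2)) : ℝ :=
  inner ℝ (fderiv ℝ (graphNormal f) x v) (fderiv ℝ (graphMap f) x w)

/-- The Gaussian curvature `det II / det I` of the graph of `f` at the point over `x`. -/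
def gaussCurvature (f : EuclideanSpace ℝ (Fin 2) → ℝ) (x : EuclideanSpace ℝ (Fin 2)) : ℝ :=
  (Matrix.of fun i j : Fin 2 =>
      secondForm f x (EuclideanSpace.single i 1) (EuclideanSpace.single j 1)).det /
    (Matrix.of fun i j : Fin 2 =>
      firstForm f x (EuclideanSpace.single i 1) (EuclideanSpace.single j 1)).det

/-- The point of the graph of `f` over `x` is umbilic: the second fundamental form is a multiple of
the first, that is, the principal curvatures coincide. -/
def IsUmbilic (f : EuclideanSpace ℝ (Fin 2) → ℝ) (x : EuclideanSpace ℝ (Fin 2)) : Prop :=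
  ∃ k : ℝ, ∀ v w : EuclideanSpace ℝ (Fin 2), secondForm f x v w = k * firstForm f x v w

end

/-!
The two surfaces `X x` and `X x + r n x` have the same normal `n x` over `x`, and the nearest
point of the graph to `X x + r n x` is `X x`, because the graph lies below its tangent planes. A
unit speed curve on a surface is a geodesic when its velocity changes only in the direction of
the normal. So if `Π` carries the geodesic with velocity `w` to a geodesic with unit tangent `T`,
then `T` and `w` are tangent fields along the same curve of normals whose derivatives are both
normal, and the angle between them is constant. If this geodesic starts in a principal direction,
the angle vanishes at the start, hence always, and the curve is a line of curvature
(`IsParallelGeodesic.isPrincipal`). Along it `n' = κ w` and `w' = -κ n`, so that `n` runs through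
a great circle of the sphere (`IsConcavePatch.exists_great_circle`).

Near a point of nonzero Gaussian curvature the Gauss map is injective and immersive. If the point
were not umbilic, the two families of lines of curvature would thus become two orthogonal
families of great circles on an open part of the sphere. Such families do not exist, since the
great circles orthogonal to a given one all pass through its poles, while the curves orthogonal
to these are circles of latitude (`IsConcavePatch.isUmbilic_of_injective`). So every point of
nonzero curvature is umbilic. On an open umbilic set the principal curvature is locally constant
(`IsConcavePatch.umbilic_curvature_const`), hence the points with a given nonzero principal
curvature form an open and closed set, and by connectedness either the curvature vanishes
identically or the whole patch is umbilic.

The surfaces are only of class `C²`. Geodesics of the parallel surface are obtained from Peano's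
existence theorem, since their equation has merely continuous coefficients in these coordinates,
and the argument uses neither uniqueness of geodesics nor derivatives of the curvatures.
-/

open Metric Set Filter Topology

/-! ### Peano existence theorem -/

/-- **Peano existence theorem** for an autonomous equation with continuous right hand side. The
field is approximated uniformly by smooth fields, whose integral curves are equi-Lipschitz, and a limit of
these curves is taken. -/
theorem exists_hasDerivAt_of_continuousOn_closedBall {E : Type*} [NormedAddCommGroup E]
    [NormedSpace ℝ E] [FiniteDimensional ℝ E] {f : E → E} {z : E} {a M δ : ℝ} (ha : 0 < a)
    (hf : ContinuousOn f (closedBall z a)) (hM : ∀ x ∈ closedBall z a, ‖f x‖ ≤ M)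
    (hδ : 0 < δ) (hMδ : (M + 1) * δ ≤ a) :
    ∃ α : ℝ → E, α 0 = z ∧ ∀ t ∈ Ioo (-δ) δ, α t ∈ closedBall z a ∧ HasDerivAt α (f (α t)) t := by
  classical
  have hM0 : 0 ≤ M := (norm_nonneg _).trans (hM z (mem_closedBall_self ha.le))
  -- A globally continuous extension, which smooth fields can approximate uniformly.
  obtain ⟨F, hF⟩ := ContinuousMap.exists_restrict_eq (isClosed_closedBall (x := z) (ε := a))
    ⟨(closedBall z a).domRestrict f, hf.domRestrict⟩
  have hFf : ∀ x ∈ closedBall z a, F x = f x := fun x hx => by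
    exact DFunLike.congr_fun hF ⟨x, hx⟩
  have hε : ∀ n : ℕ, 0 < 1 / ((n : ℝ) + 1) := fun n => by positivity
  have hε1 : ∀ n : ℕ, 1 / ((n : ℝ) + 1) ≤ 1 := fun n => by
    rw [div_le_one (by positivity)]; linarith [n.cast_nonneg (α := ℝ)]
  choose g hgC hgF _ using fun n : ℕ => F.continuous.exists_contDiff_approx 1
    (continuous_const (y := 1 / ((n : ℝ) + 1))) (fun _ => hε n)
  have hgM : ∀ n, ∀ x ∈ closedBall z a, ‖g n x‖ ≤ M + 1 := fun n x hx => by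
    have h1 := (hgF n x).le.trans (hε1 n)
    rw [dist_eq_norm] at h1
    have h2 := norm_le_norm_add_norm_sub' (g n x) (F x)
    have h3 := hM x hx
    rw [← hFf x hx] at h3
    linarith
  have h0 : (0 : ℝ) ∈ Icc (-δ) δ := ⟨by linarith, hδ.le⟩
  let t₀ : Icc (-δ) δ := ⟨0, h0⟩
  let L : NNReal := ⟨M + 1, by linarith⟩
  let a' : NNReal := ⟨a, ha.le⟩
  have hmax : (L : ℝ) * max (δ - t₀) (t₀ - -δ) ≤ a' - (0 : NNReal) := by
    change (M + 1) * max (δ - 0) (0 - -δ) ≤ a - 0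
    simpa using hMδ
  have hPL : ∀ n, ∃ K, IsPicardLindelof (fun _ : ℝ => g n) t₀ z a' 0 L K := fun n => by
    obtain ⟨K, hK⟩ := (hgC n).contDiffOn.exists_lipschitzOnWith (by simp)
      (convex_closedBall z a) (isCompact_closedBall z a)
    exact ⟨K, .of_time_independent (hgM n) hK hmax⟩
  choose K hK using hPL
  have hz : z ∈ closedBall z ((0 : NNReal) : ℝ) := by simp
  choose u hu using fun n => ODE.FunSpace.exists_isFixedPt_next (hK n) hz
  have hu' : ∀ n t, u n t = z + ∫ s in (0 : ℝ)..t, g n ((u n).compProj s) := fun n t =>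
    (ODE.FunSpace.isFixedPt_next_iff (hK n) hz).1 (hu n) t
  have hub : ∀ n s, (u n).compProj s ∈ closedBall z a := fun n s =>
    (u n).compProj_mem_closedBall hmax
  let v : ℕ → BoundedContinuousFunction (Icc (-δ) δ) E := fun n =>
    BoundedContinuousFunction.mkOfCompact (u n).toContinuousMap
  have hcomp : IsCompact (closure (range v)) := by
    refine BoundedContinuousFunction.arzela_ascoli (closedBall z a) (isCompact_closedBall z a)
      _ ?_ ?_
    · rintro _ t ⟨n, rfl⟩
      exact (u n).mem_closedBall hmax
    · refine (LipschitzWith.uniformEquicontinuous _ L ?_).equicontinuous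
      rintro ⟨_, n, rfl⟩
      exact (u n).lipschitzWith
  -- A subsequence converges by Arzelà–Ascoli, and the integral equation passes to the limit.
  obtain ⟨w, -, φ, hφ, hw⟩ := hcomp.tendsto_subseq (fun n => subset_closure (mem_range_self n))
  have hδδ : -δ ≤ δ := by linarith
  let α : ℝ → E := fun t => w (projIcc (-δ) δ hδδ t)
  have hlim : ∀ t, Tendsto (fun n => (u (φ n)).compProj t) atTop (𝓝 (α t)) := fun t =>
    ((BoundedContinuousFunction.lipschitz_eval_const
      (projIcc (-δ) δ hδδ t)).continuous.tendsto w).comp hw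
  have hαc : Continuous α := w.continuous.comp continuous_projIcc
  have hαb : ∀ t, α t ∈ closedBall z a := fun t =>
    isClosed_closedBall.mem_of_tendsto (hlim t) (Eventually.of_forall fun n => hub _ t)
  have hint : ∀ t ∈ Icc (-δ) δ, α t = z + ∫ s in (0 : ℝ)..t, F (α s) := fun t ht => by
    have h1 : Tendsto (fun n => ∫ s in (0 : ℝ)..t, g (φ n) ((u (φ n)).compProj s)) atTop
        (𝓝 (∫ s in (0 : ℝ)..t, F (α s))) := by
      refine intervalIntegral.tendsto_integral_filter_of_dominated_convergence (fun _ => M + 1)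
        ?_ ?_ ?_ ?_
      · exact Eventually.of_forall fun n =>
          (((hgC (φ n)).continuous.comp (u (φ n)).continuous_compProj)).aestronglyMeasurable
      · exact Eventually.of_forall fun n => Eventually.of_forall fun s _ => hgM _ _ (hub _ s)
      · simp
      · refine Eventually.of_forall fun s _ => ?_
        have h2 := (F.continuous.tendsto _).comp (hlim s)
        refine h2.congr_dist ?_
        refine squeeze_zero (fun _ => dist_nonneg) (fun n => ?_)
          ((tendsto_one_div_add_atTop_nhds_zero_nat (𝕜 := ℝ)).comp hφ.tendsto_atTop)
        rw [dist_comm]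
        exact (hgF (φ n) _).le
    refine tendsto_nhds_unique (hlim t) ?_
    have h3 : (fun n => (u (φ n)).compProj t)
        = fun n => z + ∫ s in (0 : ℝ)..t, g (φ n) ((u (φ n)).compProj s) := by
      funext n
      rw [ODE.FunSpace.compProj_of_mem ht, hu']
    rw [h3]
    exact h1.const_add z
  have hd : ∀ t ∈ Ioo (-δ) δ, HasDerivAt α (f (α t)) t := fun t ht => by
    have h1 : HasDerivAt (fun t => z + ∫ s in (0 : ℝ)..t, F (α s)) (F (α t)) t :=
      ((F.continuous.comp hαc).integral_hasStrictDerivAt 0 t).hasDerivAt.const_add z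
    rw [← hFf _ (hαb t)]
    refine h1.congr_of_eventuallyEq ?_
    filter_upwards [Ioo_mem_nhds ht.1 ht.2] with s hs using hint s ⟨hs.1.le, hs.2.le⟩
  exact ⟨α, by simpa using hint 0 h0, fun t ht => ⟨hαb t, hd t ht⟩⟩

/-! ### First and second fundamental forms of a concave graph -/

/-- The parameter plane. -/
abbrev Plane := EuclideanSpace ℝ (Fin 2)

/-- The ambient space of the surfaces. -/
abbrev Space := EuclideanSpace ℝ (Fin 3)

/-- A `C²` function on an open set of the plane whose graph lies below each of its tangent
planes. -/
structure IsConcavePatch (f : Plane → ℝ) (D : Set Plane) : Prop where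
  isOpen : IsOpen D
  contDiffOn : ContDiffOn ℝ 2 f D
  le_tangent : ∀ x ∈ D, ∀ y ∈ D, f y ≤ f x + fderiv ℝ f x (y - x)

/-- The orthogonal projection of space to the horizontal parameter plane. -/
noncomputable def horizontal : Space →L[ℝ] Plane :=
  LinearMap.toContinuousLinearMap
    { toFun := fun u => !₂[u 0, u 1]
      map_add' := fun u v => by ext i; fin_cases i <;> simp
      map_smul' := fun c u => by ext i; fin_cases i <;> simp }

@[simp] theorem horizontal_apply_zero (u : Space) : horizontal u 0 = u 0 := by simp [horizontal]

@[simp] theorem horizontal_apply_one (u : Space) : horizontal u 1 = u 1 := by simp [horizontal]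

theorem fderiv_eq_partialD (f : Plane → ℝ) (x v : Plane) :
    fderiv ℝ f x v = v 0 * partialD 0 f x + v 1 * partialD 1 f x := by
  have h : v = v 0 • EuclideanSpace.single 0 1 + v 1 • EuclideanSpace.single 1 1 := by
    ext i; fin_cases i <;> simp
  conv_lhs => rw [h]
  simp [partialD]

theorem norm_graphNormal (f : Plane → ℝ) (x : Plane) : ‖graphNormal f x‖ = 1 := by
  have h : 0 < 1 + partialD 0 f x ^ 2 + partialD 1 f x ^ 2 := by positivity
  rw [graphNormal, norm_smul, EuclideanSpace.norm_eq]
  simp only [Fin.sum_univ_three, Real.norm_eq_abs, sq_abs]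
  simp only [Matrix.cons_val]
  rw [abs_of_nonneg (by positivity), neg_sq, neg_sq, one_pow,
    show partialD 0 f x ^ 2 + partialD 1 f x ^ 2 + 1 = 1 + partialD 0 f x ^ 2 + partialD 1 f x ^ 2 by
      ring]
  exact inv_mul_cancel₀ (Real.sqrt_pos.2 h).ne'

theorem graphNormal_apply_two_pos (f : Plane → ℝ) (x : Plane) : 0 < graphNormal f x 2 := by
  have h : 0 < 1 + partialD 0 f x ^ 2 + partialD 1 f x ^ 2 := by positivity
  simpa [graphNormal] using h

theorem inner_graphNormal (f : Plane → ℝ) (x : Plane) (u : Space) :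
    inner ℝ (graphNormal f x) u = graphNormal f x 2 *
      (u 2 - fderiv ℝ f x (horizontal u)) := by
  rw [fderiv_eq_partialD]
  simp [graphNormal, PiLp.inner_apply, Fin.sum_univ_three]
  ring

/-- The tangent plane over `x` is a graph over the parameter plane. -/
theorem horizontal_injOn (f : Plane → ℝ) (x : Plane) {u v : Space}
    (hu : inner ℝ (graphNormal f x) u = 0) (hv : inner ℝ (graphNormal f x) v = 0)
    (h : horizontal u = horizontal v) : u = v := by
  rw [inner_graphNormal] at hu hv
  have hn := (graphNormal_apply_two_pos f x).ne'
  have h0 : u 0 = v 0 := by simpa using congrArg (fun z : Plane => z 0) h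
  have h1 : u 1 = v 1 := by simpa using congrArg (fun z : Plane => z 1) h
  have hu' := (mul_eq_zero.1 hu).resolve_left hn
  have hv' := (mul_eq_zero.1 hv).resolve_left hn
  rw [h] at hu'
  have h2 : u 2 = v 2 := by linarith
  ext i; fin_cases i <;> assumption

namespace IsConcavePatch

variable {f : Plane → ℝ} {D : Set Plane} (hf : IsConcavePatch f D) {x : Plane} (hx : x ∈ D)
include hf

theorem contDiffOn_fderiv : ContDiffOn ℝ 1 (fderiv ℝ f) D :=
  hf.contDiffOn.fderiv_of_isOpen hf.isOpen (by norm_num)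

theorem contDiffOn_partialD (i : Fin 2) : ContDiffOn ℝ 1 (partialD i f) D :=
  hf.contDiffOn_fderiv.clm_apply contDiffOn_const

theorem contDiffOn_graphMap : ContDiffOn ℝ 2 (graphMap f) D := by
  rw [contDiffOn_euclidean]
  have h := hf.contDiffOn
  intro i
  fin_cases i <;> simp [graphMap]
  · fun_prop
  · fun_prop
  · exact h

theorem contDiffOn_graphNormal : ContDiffOn ℝ 1 (graphNormal f) D := by
  have h0 := hf.contDiffOn_partialD 0
  have h1 := hf.contDiffOn_partialD 1
  have hpos : ∀ x, 1 + partialD 0 f x ^ 2 + partialD 1 f x ^ 2 ≠ 0 := fun x => by positivity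
  refine ContDiffOn.smul (ContDiffOn.inv (ContDiffOn.sqrt ?_ fun x _ => hpos x) fun x _ => ?_) ?_
  · fun_prop
  · exact Real.sqrt_ne_zero'.2 (by positivity)
  · rw [contDiffOn_euclidean]
    intro i
    fin_cases i <;> simp
    · exact h0.neg
    · exact h1.neg
    · exact contDiffOn_const

include hx

theorem hasFDerivAt : HasFDerivAt f (fderiv ℝ f x) x :=
  ((hf.contDiffOn.contDiffAt (hf.isOpen.mem_nhds hx)).differentiableAt (by norm_num)).hasFDerivAt

theorem hasFDerivAt_fderiv : HasFDerivAt (fderiv ℝ f) (fderiv ℝ (fderiv ℝ f) x) x :=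
  ((hf.contDiffOn_fderiv.contDiffAt (hf.isOpen.mem_nhds hx)).differentiableAt
    (by norm_num)).hasFDerivAt

theorem hasFDerivAt_graphMap : HasFDerivAt (graphMap f) (fderiv ℝ (graphMap f) x) x :=
  ((hf.contDiffOn_graphMap.contDiffAt (hf.isOpen.mem_nhds hx)).differentiableAt
    (by norm_num)).hasFDerivAt

theorem hasFDerivAt_graphNormal : HasFDerivAt (graphNormal f) (fderiv ℝ (graphNormal f) x) x :=
  ((hf.contDiffOn_graphNormal.contDiffAt (hf.isOpen.mem_nhds hx)).differentiableAt
    (by norm_num)).hasFDerivAt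

theorem fderiv_graphMap_apply (v : Plane) :
    fderiv ℝ (graphMap f) x v = !₂[v 0, v 1, fderiv ℝ f x v] := by
  ext i
  have hi : HasFDerivAt (fun y => graphMap f y i)
      ((EuclideanSpace.proj i : Space →L[ℝ] ℝ).comp (fderiv ℝ (graphMap f) x)) x :=
    (EuclideanSpace.proj i : Space →L[ℝ] ℝ).hasFDerivAt.comp x (hf.hasFDerivAt_graphMap hx)
  fin_cases i
  · have h0 : HasFDerivAt (fun y : Plane => y 0) (EuclideanSpace.proj 0 : Plane →L[ℝ] ℝ) x :=
      (EuclideanSpace.proj 0 : Plane →L[ℝ] ℝ).hasFDerivAt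
    simpa using DFunLike.congr_fun (hi.unique h0) v
  · have h0 : HasFDerivAt (fun y : Plane => y 1) (EuclideanSpace.proj 1 : Plane →L[ℝ] ℝ) x :=
      (EuclideanSpace.proj 1 : Plane →L[ℝ] ℝ).hasFDerivAt
    simpa using DFunLike.congr_fun (hi.unique h0) v
  · simpa using DFunLike.congr_fun (hi.unique (hf.hasFDerivAt hx)) v

theorem horizontal_fderiv_graphMap (v : Plane) : horizontal (fderiv ℝ (graphMap f) x v) = v := by
  rw [hf.fderiv_graphMap_apply hx]
  ext i; fin_cases i <;> simp

theorem inner_graphNormal_fderiv_graphMap (v : Plane) :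
    inner ℝ (graphNormal f x) (fderiv ℝ (graphMap f) x v) = 0 := by
  rw [inner_graphNormal, hf.horizontal_fderiv_graphMap hx, hf.fderiv_graphMap_apply hx]
  simp

theorem fderiv_graphMap_horizontal {u : Space} (hu : inner ℝ (graphNormal f x) u = 0) :
    fderiv ℝ (graphMap f) x (horizontal u) = u :=
  horizontal_injOn f x (hf.inner_graphNormal_fderiv_graphMap hx _) hu
    (hf.horizontal_fderiv_graphMap hx _)

theorem inner_graphNormal_fderiv_graphNormal (v : Plane) :
    inner ℝ (graphNormal f x) (fderiv ℝ (graphNormal f) x v) = 0 := by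
  have h := (hf.hasFDerivAt_graphNormal hx).inner ℝ (hf.hasFDerivAt_graphNormal hx)
  have h1 : (fun y => inner ℝ (graphNormal f y) (graphNormal f y) : Plane → ℝ) = fun _ => 1 := by
    funext y; rw [real_inner_self_eq_norm_sq, norm_graphNormal]; norm_num
  rw [h1] at h
  have h2 := DFunLike.congr_fun (h.unique (hasFDerivAt_const (1 : ℝ) x)) v
  simp [fderivInnerCLM_apply] at h2
  rw [real_inner_comm (graphNormal f x) (fderiv ℝ (graphNormal f) x v)] at h2
  linarith

/-- The Weingarten equation: the second fundamental form of a graph is a multiple of its Hessian. -/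
theorem secondForm_eq (v w : Plane) :
    secondForm f x v w = -(graphNormal f x 2 * fderiv ℝ (fderiv ℝ f) x v w) := by
  have h1 : HasFDerivAt (fun y => (fderiv ℝ f y w)) ((fderiv ℝ (fderiv ℝ f) x).flip w) x :=
    by simpa using! (hf.hasFDerivAt_fderiv hx).clm_apply (hasFDerivAt_const w x)
  let e : Space := EuclideanSpace.single 2 1
  let w' : Space := !₂[w 0, w 1, 0]
  have h2 : HasFDerivAt (fun y => w' + (fderiv ℝ f y w) • e)
      (((fderiv ℝ (fderiv ℝ f) x).flip w).smulRight e) x := (h1.smul_const e).const_add w'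
  have h3 := (hf.hasFDerivAt_graphNormal hx).inner ℝ h2
  have hw : ∀ y ∈ D, w' + (fderiv ℝ f y w) • e = fderiv ℝ (graphMap f) y w := fun y hy => by
    rw [hf.fderiv_graphMap_apply hy]
    ext i; fin_cases i <;> simp [e, w']
  have h4 : (fun y => inner ℝ (graphNormal f y) (w' + (fderiv ℝ f y w) • e) : Plane → ℝ)
      =ᶠ[𝓝 x] fun _ => 0 := by
    filter_upwards [hf.isOpen.mem_nhds hx] with y hy
    rw [hw y hy, hf.inner_graphNormal_fderiv_graphMap hy]
  have h5 := DFunLike.congr_fun ((h3.congr_of_eventuallyEq h4.symm).unique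
    (hasFDerivAt_const (0 : ℝ) x)) v
  simp [fderivInnerCLM_apply] at h5
  rw [hw x hx] at h5
  simp only [e, inner_smul_right, EuclideanSpace.inner_single_right] at h5
  simp at h5
  rw [secondForm]
  linarith

theorem secondForm_comm (v w : Plane) : secondForm f x v w = secondForm f x w v := by
  rw [hf.secondForm_eq hx, hf.secondForm_eq hx]
  have := (hf.contDiffOn.contDiffAt (hf.isOpen.mem_nhds hx)).isSymmSndFDerivAt (by simp)
  rw [this v w]

theorem secondForm_self_nonneg (v : Plane) : 0 ≤ secondForm f x v v := by
  rw [hf.secondForm_eq hx, neg_nonneg]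
  refine mul_nonpos_of_nonneg_of_nonpos (graphNormal_apply_two_pos f x).le ?_
  have hl : HasDerivAt (fun t : ℝ => x + t • v) v 0 := by
    simpa using ((hasDerivAt_id (0 : ℝ)).smul_const v).const_add x
  have h1 : HasDerivAt (fun t : ℝ => fderiv ℝ f (x + t • v) v) (fderiv ℝ (fderiv ℝ f) x v v) 0 := by
    have h0 : HasFDerivAt (fderiv ℝ f) (fderiv ℝ (fderiv ℝ f) x) (x + (0 : ℝ) • v) := by
      simpa using hf.hasFDerivAt_fderiv hx
    exact (ContinuousLinearMap.apply ℝ ℝ v).hasFDerivAt.comp_hasDerivAt (0 : ℝ)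
      (h0.comp_hasDerivAt (0 : ℝ) hl)
  have h2 := (hasDerivAt_iff_tendsto_slope.1 h1).mono_left (nhdsGT_le_nhdsNE 0)
  refine le_of_tendsto h2 ?_
  have h3 : ∀ᶠ t : ℝ in 𝓝[>] 0, x + t • v ∈ D := by
    refine (hl.continuousAt.eventually_mem ?_).filter_mono nhdsWithin_le_nhds
    simpa using hf.isOpen.mem_nhds hx
  filter_upwards [h3, self_mem_nhdsWithin] with t ht ht0
  have ht0 : 0 < t := ht0
  have e1 := hf.le_tangent x hx _ ht
  have e2 := hf.le_tangent _ ht x hx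
  simp only [add_sub_cancel_left, sub_add_cancel_left, map_smul, map_neg, smul_eq_mul] at e1 e2
  rw [slope_def_field]
  simp only [zero_smul, add_zero, sub_zero]
  refine div_nonpos_of_nonpos_of_nonneg ?_ ht0.le
  nlinarith

/-- Adding an outward multiple of the normal to a convex surface does not decrease tangent vectors,
so that the parallel surface is immersed. -/
theorem fderiv_parallel_injective {r : ℝ} (hr : 0 ≤ r) :
    Function.Injective (fderiv ℝ (graphMap f) x + r • fderiv ℝ (graphNormal f) x) := by
  rw [injective_iff_map_eq_zero]
  intro v hv
  have h1 : inner ℝ (fderiv ℝ (graphMap f) x v + r • fderiv ℝ (graphNormal f) x v)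
      (fderiv ℝ (graphMap f) x v) = 0 := by
    have hv' : fderiv ℝ (graphMap f) x v + r • fderiv ℝ (graphNormal f) x v = 0 := by simpa using hv
    rw [hv', inner_zero_left]
  rw [inner_add_left, real_inner_smul_left, real_inner_self_eq_norm_sq] at h1
  have h2 : 0 ≤ r * inner ℝ (fderiv ℝ (graphNormal f) x v) (fderiv ℝ (graphMap f) x v) :=
    mul_nonneg hr (hf.secondForm_self_nonneg hx v)
  have h3 : fderiv ℝ (graphMap f) x v = 0 := by
    rw [← norm_eq_zero]; nlinarith [norm_nonneg (fderiv ℝ (graphMap f) x v)]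
  rw [← hf.horizontal_fderiv_graphMap hx v, h3, map_zero]

theorem hasFDerivAt_parallelMap (r : ℝ) : HasFDerivAt (parallelMap f r)
    (fderiv ℝ (graphMap f) x + r • fderiv ℝ (graphNormal f) x) x :=
  (hf.hasFDerivAt_graphMap hx).add ((hf.hasFDerivAt_graphNormal hx).const_smul r)

/-- The parallel surface has the same tangent plane over `x` as the graph. -/
theorem inner_graphNormal_fderiv_parallelMap (r : ℝ) (v : Plane) :
    inner ℝ (graphNormal f x) (fderiv ℝ (parallelMap f r) x v) = 0 := by
  rw [(hf.hasFDerivAt_parallelMap hx r).fderiv]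
  simp [inner_add_right, inner_smul_right, hf.inner_graphNormal_fderiv_graphMap hx,
    hf.inner_graphNormal_fderiv_graphNormal hx]

/-- The foot point `X x` is a nearest point of the graph to the point `X x + r n x` outside it. -/
theorem graphMap_mem_nearestPoints {r : ℝ} (hr : 0 ≤ r) :
    graphMap f x ∈ nearestPoints (graphMap f '' D) (parallelMap f r x) := by
  refine ⟨mem_image_of_mem _ hx, ?_⟩
  rintro _ ⟨y, hy, rfl⟩
  rw [dist_eq_norm, dist_eq_norm, parallelMap, add_sub_cancel_left]
  have h1 : inner ℝ (graphNormal f x) (graphMap f x - graphMap f y) ≥ 0 := by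
    rw [inner_graphNormal]
    refine mul_nonneg (graphNormal_apply_two_pos f x).le ?_
    have h2 : horizontal (graphMap f x - graphMap f y) = -(y - x) := by
      ext i; fin_cases i <;> simp [graphMap]
    rw [h2, map_neg]
    have := hf.le_tangent x hx y hy
    simp only [graphMap, PiLp.sub_apply, Matrix.cons_val]
    linarith
  refine (sq_le_sq₀ (norm_nonneg _) (norm_nonneg _)).1 ?_
  rw [show graphMap f x + r • graphNormal f x - graphMap f y
    = r • graphNormal f x + (graphMap f x - graphMap f y) by abel, norm_add_sq_real,
    real_inner_smul_left]
  nlinarith [mul_nonneg hr h1, sq_nonneg ‖graphMap f x - graphMap f y‖]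

end IsConcavePatch

/-! ### Geodesics of the parallel surface -/

theorem eq_of_hasDerivAt_zero_Ioo {E : Type*} [NormedAddCommGroup E] [NormedSpace ℝ E] {g : ℝ → E}
    {δ : ℝ} (h : ∀ t ∈ Ioo (-δ) δ, HasDerivAt g 0 t) {t : ℝ} (ht : t ∈ Ioo (-δ) δ) : g t = g 0 := by
  have h0 : (0 : ℝ) ∈ Ioo (-δ) δ := by
    obtain ⟨h1, h2⟩ := ht
    constructor <;> linarith
  exact isOpen_Ioo.is_const_of_deriv_eq_zero isPreconnected_Ioo
    (fun s hs => (h s hs).differentiableAt.differentiableWithinAt)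
    (fun s hs => (h s hs).deriv) ht h0

/-- The inverse of the differential of `parallelMap f r` at `x`, on its tangent plane: it sends a
tangent vector of the parallel surface to its components in the parameter plane. -/
noncomputable def parallelInv (f : Plane → ℝ) (r : ℝ) (x : Plane) : Space →L[ℝ] Plane :=
  (Ring.inverse (horizontal ∘L (fderiv ℝ (graphMap f) x + r • fderiv ℝ (graphNormal f) x))) ∘L
    horizontal

/-- The normal curvature of the parallel surface in the direction of the unit tangent vector `u`:
the component along `u` of the derivative of the normal. -/
noncomputable def parallelCurvature (f : Plane → ℝ) (r : ℝ) (x : Plane) (u : Space) : ℝ :=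
  inner ℝ u (fderiv ℝ (graphNormal f) x (parallelInv f r x u))

/-- `y` is the trace in the parameter plane, and `w` the velocity, of a unit speed geodesic of the
parallel surface at distance `r`, defined for parameters in `(-δ, δ)`. -/
structure IsParallelGeodesic (f : Plane → ℝ) (D : Set Plane) (r δ : ℝ) (y : ℝ → Plane)
    (w : ℝ → Space) : Prop where
  mem : ∀ t ∈ Ioo (-δ) δ, y t ∈ D
  norm_eq : ∀ t ∈ Ioo (-δ) δ, ‖w t‖ = 1
  inner_eq : ∀ t ∈ Ioo (-δ) δ, inner ℝ (graphNormal f (y t)) (w t) = 0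
  hasDerivAt : ∀ t ∈ Ioo (-δ) δ, HasDerivAt y (parallelInv f r (y t) (w t)) t
  hasDerivAt_velocity : ∀ t ∈ Ioo (-δ) δ,
    HasDerivAt w (-parallelCurvature f r (y t) (w t) • graphNormal f (y t)) t

namespace IsConcavePatch

variable {f : Plane → ℝ} {D : Set Plane} (hf : IsConcavePatch f D)
include hf

theorem continuousOn_fderiv_graphMap : ContinuousOn (fderiv ℝ (graphMap f)) D :=
  hf.contDiffOn_graphMap.continuousOn_fderiv_of_isOpen hf.isOpen (by norm_num)

theorem continuousOn_fderiv_graphNormal : ContinuousOn (fderiv ℝ (graphNormal f)) D :=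
  hf.contDiffOn_graphNormal.continuousOn_fderiv_of_isOpen hf.isOpen (by norm_num)

theorem isUnit_horizontal_fderiv {x : Plane} (hx : x ∈ D) {r : ℝ} (hr : 0 ≤ r) :
    IsUnit (horizontal ∘L (fderiv ℝ (graphMap f) x + r • fderiv ℝ (graphNormal f) x)) := by
  rw [ContinuousLinearMap.isUnit_iff_bijective]
  have hi : Function.Injective
      (horizontal ∘L (fderiv ℝ (graphMap f) x + r • fderiv ℝ (graphNormal f) x)) := fun u v huv => by
    refine hf.fderiv_parallel_injective hx hr ?_
    rw [← (hf.hasFDerivAt_parallelMap hx r).fderiv] at huv ⊢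
    exact horizontal_injOn f x (hf.inner_graphNormal_fderiv_parallelMap hx r u)
      (hf.inner_graphNormal_fderiv_parallelMap hx r v) huv
  exact ⟨hi, LinearMap.injective_iff_surjective.1 hi⟩

theorem continuousOn_parallelInv {r : ℝ} (hr : 0 ≤ r) : ContinuousOn (parallelInv f r) D := by
  intro x hx
  have h1 : ContinuousWithinAt
      (fun x => horizontal ∘L (fderiv ℝ (graphMap f) x + r • fderiv ℝ (graphNormal f) x)) D x :=
    continuousWithinAt_const.clm_comp ((hf.continuousOn_fderiv_graphMap x hx).add
      ((hf.continuousOn_fderiv_graphNormal x hx).const_smul r))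
  obtain ⟨u, hu⟩ := hf.isUnit_horizontal_fderiv hx hr
  have h2 := NormedRing.inverse_continuousAt u
  rw [hu] at h2
  exact (ContinuousAt.comp_continuousWithinAt (f := fun x =>
    horizontal ∘L (fderiv ℝ (graphMap f) x + r • fderiv ℝ (graphNormal f) x)) h2 h1).clm_comp
    continuousWithinAt_const

theorem fderiv_parallelMap_parallelInv {x : Plane} (hx : x ∈ D) {r : ℝ} (hr : 0 ≤ r) {u : Space}
    (hu : inner ℝ (graphNormal f x) u = 0) :
    (fderiv ℝ (graphMap f) x + r • fderiv ℝ (graphNormal f) x) (parallelInv f r x u) = u := by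
  refine horizontal_injOn f x ?_ hu ?_
  · rw [← (hf.hasFDerivAt_parallelMap hx r).fderiv]
    exact hf.inner_graphNormal_fderiv_parallelMap hx r _
  · have h := Ring.mul_inverse_cancel _ (hf.isUnit_horizontal_fderiv hx hr)
    exact DFunLike.congr_fun h (horizontal u)

theorem continuousOn_parallelCurvature {r : ℝ} (hr : 0 ≤ r) :
    ContinuousOn (fun z : Plane × Space => parallelCurvature f r z.1 z.2) (D ×ˢ univ) := by
  have hfst : MapsTo (Prod.fst : Plane × Space → Plane) (D ×ˢ univ) D := fun z hz => hz.1
  have h1 := (hf.continuousOn_parallelInv hr).comp continuousOn_fst hfst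
  have h2 := hf.continuousOn_fderiv_graphNormal.comp continuousOn_fst hfst
  exact continuousOn_snd.inner (𝕜 := ℝ) (h2.clm_apply (h1.clm_apply continuousOn_snd))

/-- Local existence of geodesics of the parallel surface, for a time that is uniform in the initial
data. The parallel surface is parametrized by a map which is only `C¹`, so that the geodesic
equation has merely continuous coefficients. -/
theorem exists_isParallelGeodesic {r : ℝ} (hr : 0 ≤ r) {p : Plane} (hp : p ∈ D) {V : Set Plane}
    (hV : V ∈ 𝓝 p) : ∃ V₁ ∈ 𝓝 p, ∃ δ > 0, ∀ x ∈ V₁, ∀ u : Space, ‖u‖ = 1 →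
      inner ℝ (graphNormal f x) u = 0 → ∃ y w, y 0 = x ∧ w 0 = u ∧
        IsParallelGeodesic f D r δ y w ∧ ∀ t ∈ Ioo (-δ) δ, y t ∈ V := by
  let φ : Plane × Space → Plane × Space := fun z =>
    (parallelInv f r z.1 z.2, -parallelCurvature f r z.1 z.2 • graphNormal f z.1)
  have hφ : ContinuousOn φ (D ×ˢ univ) := by
    have hfst : MapsTo (Prod.fst : Plane × Space → Plane) (D ×ˢ univ) D := fun z hz => hz.1
    have h1 := (hf.continuousOn_parallelInv hr).comp continuousOn_fst hfst
    have h3 := hf.contDiffOn_graphNormal.continuousOn.comp continuousOn_fst hfst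
    exact (h1.clm_apply continuousOn_snd).prodMk
      ((hf.continuousOn_parallelCurvature hr).neg.smul h3)
  obtain ⟨R, hR, hRV⟩ := Metric.nhds_basis_closedBall.mem_iff.1
    (inter_mem hV (hf.isOpen.mem_nhds hp))
  have hK : IsCompact (closedBall p R ×ˢ closedBall (0 : Space) 2) :=
    (isCompact_closedBall _ _).prod (isCompact_closedBall _ _)
  have hKD : closedBall p R ×ˢ closedBall (0 : Space) 2 ⊆ D ×ˢ univ :=
    fun z hz => ⟨(hRV hz.1).2, mem_univ _⟩
  obtain ⟨M, hM⟩ := hK.exists_bound_of_continuousOn (hφ.mono hKD)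
  have hM0 : 0 ≤ M := (norm_nonneg _).trans
    (hM (p, 0) ⟨mem_closedBall_self hR.le, mem_closedBall_self (by norm_num)⟩)
  let a := min (R / 2) 1
  have ha : 0 < a := lt_min (by positivity) one_pos
  refine ⟨ball p (R / 2), ball_mem_nhds _ (by positivity), a / (M + 1), by positivity, ?_⟩
  intro x hx u hu hxu
  have hsub : closedBall (x, u) a ⊆ closedBall p R ×ˢ closedBall (0 : Space) 2 := by
    rw [← closedBall_prod_same]
    refine prod_mono (closedBall_subset_closedBall' ?_) (closedBall_subset_closedBall' ?_)
    · have h1 := mem_ball.1 hx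
      have h2 := min_le_left (R / 2) 1
      linarith
    · have h2 := min_le_right (R / 2) 1
      rw [dist_zero_right, hu]
      linarith
  obtain ⟨α, hα0, hα⟩ := exists_hasDerivAt_of_continuousOn_closedBall ha
    (hφ.mono (hsub.trans hKD)) (fun z hz => hM z (hsub hz)) (δ := a / (M + 1)) (by positivity)
    (by rw [mul_div_cancel₀ _ (by positivity)])
  set δ := a / (M + 1)
  have hD : ∀ t ∈ Ioo (-δ) δ, (α t).1 ∈ V ∩ D := fun t ht => hRV (hsub (hα t ht).1).1
  have hd1 : ∀ t ∈ Ioo (-δ) δ, HasDerivAt (fun t => (α t).1)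
      (parallelInv f r (α t).1 (α t).2) t := fun t ht => (hα t ht).2.fst
  have hd2 : ∀ t ∈ Ioo (-δ) δ, HasDerivAt (fun t => (α t).2)
      (-parallelCurvature f r (α t).1 (α t).2 • graphNormal f (α t).1) t :=
    fun t ht => (hα t ht).2.snd
  -- Along any solution the velocity stays tangent, and then its length is constant.
  have hort : ∀ t ∈ Ioo (-δ) δ, inner ℝ (graphNormal f (α t).1) (α t).2 = 0 := fun t ht => by
    have h : ∀ t ∈ Ioo (-δ) δ,
        HasDerivAt (fun t => inner ℝ (graphNormal f (α t).1) (α t).2) 0 t := fun t ht => by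
      have h1 := ((hf.hasFDerivAt_graphNormal (hD t ht).2).comp_hasDerivAt t (hd1 t ht)).inner ℝ
        (hd2 t ht)
      refine h1.congr_deriv ?_
      rw [inner_smul_right, Function.comp_apply, real_inner_self_eq_norm_sq, norm_graphNormal,
        parallelCurvature, real_inner_comm]
      ring
    have h0 := eq_of_hasDerivAt_zero_Ioo h ht
    simp only [hα0] at h0
    rw [h0, hxu]
  have hnorm : ∀ t ∈ Ioo (-δ) δ, ‖(α t).2‖ = 1 := fun t ht => by
    have h : ∀ t ∈ Ioo (-δ) δ, HasDerivAt (fun t => inner ℝ (α t).2 (α t).2) (0 : ℝ) t :=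
        fun t ht => by
      refine ((hd2 t ht).inner ℝ (hd2 t ht)).congr_deriv ?_
      rw [inner_smul_right, inner_smul_left, real_inner_comm, hort t ht]
      simp
    have h0 := eq_of_hasDerivAt_zero_Ioo h ht
    simp only [hα0, real_inner_self_eq_norm_sq, hu] at h0
    rw [← sq_eq_sq₀ (norm_nonneg _) zero_le_one, h0]
  exact ⟨fun t => (α t).1, fun t => (α t).2, by simp [hα0], by simp [hα0],
    ⟨fun t ht => (hD t ht).2, hnorm, hort, hd1, hd2⟩, fun t ht => (hD t ht).1⟩

end IsConcavePatch

namespace IsParallelGeodesic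

variable {f : Plane → ℝ} {D : Set Plane} (hf : IsConcavePatch f D) {r δ : ℝ} (hr : 0 ≤ r)
  {y : ℝ → Plane} {w : ℝ → Space} (hy : IsParallelGeodesic f D r δ y w)
include hf hr hy

theorem hasDerivAt_parallelMap {t : ℝ} (ht : t ∈ Ioo (-δ) δ) :
    HasDerivAt (fun t => parallelMap f r (y t)) (w t) t := by
  have h := (hf.hasFDerivAt_parallelMap (hy.mem t ht) r).comp_hasDerivAt t (hy.hasDerivAt t ht)
  rwa [hf.fderiv_parallelMap_parallelInv (hy.mem t ht) hr (hy.inner_eq t ht)] at h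

theorem continuousOn_curvature :
    ContinuousOn (fun t => parallelCurvature f r (y t) (w t)) (Ioo (-δ) δ) :=
  (hf.continuousOn_parallelCurvature hr).comp (f := fun t => (y t, w t))
    (fun t ht => ((hy.hasDerivAt t ht).continuousAt.prodMk
      (hy.hasDerivAt_velocity t ht).continuousAt).continuousWithinAt)
    (fun t ht => ⟨hy.mem t ht, mem_univ _⟩)

theorem isGeodesic : IsGeodesic (parallelMap f r) D (Ioo (-δ) δ) fun t => parallelMap f r (y t) := by
  have hd : EqOn (deriv fun t => parallelMap f r (y t)) w (Ioo (-δ) δ) :=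
    fun t ht => (hy.hasDerivAt_parallelMap hf hr ht).deriv
  refine ⟨id, fun t => parallelMap f r (y t), contDiffOn_id, fun t _ => by simp, ?_, fun t _ => rfl⟩
  rw [image_id]
  refine ⟨?_, fun t ht => ⟨?_, y t, hy.mem t ht, rfl, fun v => ?_⟩⟩
  · rw [show (2 : WithTop ℕ∞) = 1 + 1 by norm_num, contDiffOn_succ_iff_deriv_of_isOpen isOpen_Ioo]
    refine ⟨fun t ht => (hy.hasDerivAt_parallelMap hf hr
      ht).differentiableAt.differentiableWithinAt, by simp, ContDiffOn.congr ?_ hd⟩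
    rw [show (1 : WithTop ℕ∞) = 0 + 1 by norm_num, contDiffOn_succ_iff_deriv_of_isOpen isOpen_Ioo]
    refine ⟨fun t ht => (hy.hasDerivAt_velocity t ht).differentiableAt.differentiableWithinAt,
      by simp, contDiffOn_zero.2 ?_⟩
    refine ContinuousOn.congr ?_ fun t ht => (hy.hasDerivAt_velocity t ht).deriv
    refine (hy.continuousOn_curvature hf hr).neg.smul ?_
    exact hf.contDiffOn_graphNormal.continuousOn.comp
      (fun t ht => (hy.hasDerivAt t ht).continuousAt.continuousWithinAt) hy.mem
  · rw [hd ht, hy.norm_eq t ht]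
  · rw [(hd.eventuallyEq_of_mem (isOpen_Ioo.mem_nhds ht)).deriv_eq,
      (hy.hasDerivAt_velocity t ht).deriv, inner_smul_left,
      hf.inner_graphNormal_fderiv_parallelMap (hy.mem t ht), mul_zero]

end IsParallelGeodesic

/-! ### Geodesics in principal directions are lines of curvature -/

/-- `u` is a unit tangent vector in a principal direction of the graph of `f` at the point over `x`:
the differential of the normal maps it to a multiple of itself. -/
structure IsPrincipal (f : Plane → ℝ) (x : Plane) (u : Space) : Prop where
  norm_eq : ‖u‖ = 1
  inner_eq : inner ℝ (graphNormal f x) u = 0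
  exists_eq : ∃ k : ℝ, fderiv ℝ (graphNormal f) x (horizontal u) = k • u

theorem IsConcavePatch.eq_smul_graphNormal {f : Plane → ℝ} {D : Set Plane}
    (hf : IsConcavePatch f D) {x : Plane} (hx : x ∈ D) {u : Space}
    (hu : ∀ v, inner ℝ u (fderiv ℝ (graphMap f) x v) = 0) :
    u = (inner ℝ (graphNormal f x) u : ℝ) • graphNormal f x := by
  set n := graphNormal f x
  have hn : inner ℝ n n = (1 : ℝ) := by rw [real_inner_self_eq_norm_sq, norm_graphNormal]; norm_num
  have h1 : inner ℝ n (u - (inner ℝ n u : ℝ) • n) = 0 := by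
    rw [inner_sub_right, inner_smul_right, hn]; ring
  have h2 := hu (horizontal (u - (inner ℝ n u : ℝ) • n))
  rw [hf.fderiv_graphMap_horizontal hx h1] at h2
  have h3 : inner ℝ (u - (inner ℝ n u : ℝ) • n) (u - (inner ℝ n u : ℝ) • n) = (0 : ℝ) := by
    rw [inner_sub_left, h2, inner_smul_left, h1]; simp
  exact sub_eq_zero.1 (inner_self_eq_zero.1 h3)

/-- If a curve in the graph is a geodesic up to parametrization, then its unit tangent vector moves
in the direction of the normal. -/
theorem IsGeodesic.exists_unit_tangent {f : Plane → ℝ} {D : Set Plane}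
    (hf : IsConcavePatch f D) {I : Set ℝ} (hI : IsOpen I) {γ : ℝ → Space}
    (hγ : IsGeodesic (graphMap f) D I γ) {y y' : ℝ → Plane}
    (hy : ∀ t ∈ I, HasDerivAt y (y' t) t) (hγy : ∀ t ∈ I, γ t = graphMap f (y t)) :
    ∃ T : ℝ → Space, ∀ t ∈ I, ‖T t‖ = 1 ∧
      (∃ l : ℝ, l ≠ 0 ∧ fderiv ℝ (graphMap f) (y t) (y' t) = l • T t) ∧
      ∃ μ : ℝ, HasDerivAt T (μ • graphNormal f (y t)) t := by
  obtain ⟨s, c, hs, hs0, ⟨hc, hcg⟩, hγc⟩ := hγ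
  have hsd : ∀ t ∈ I, HasStrictDerivAt s (deriv s t) t := fun t ht =>
    (hs.contDiffAt (hI.mem_nhds ht)).hasStrictDerivAt (by norm_num)
  have hJ : IsOpen (s '' I) := by
    rw [isOpen_iff_mem_nhds]
    rintro _ ⟨t, ht, rfl⟩
    rw [← (hsd t ht).map_nhds_eq (hs0 t ht)]
    exact image_mem_map (hI.mem_nhds ht)
  have hc1 : ∀ u ∈ s '' I, HasDerivAt c (deriv c u) u := fun u hu =>
    ((hc.contDiffAt (hJ.mem_nhds hu)).differentiableAt (by norm_num)).hasDerivAt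
  have hc2 : ∀ u ∈ s '' I, HasDerivAt (deriv c) (deriv (deriv c) u) u := fun u hu =>
    ((((contDiffOn_succ_iff_deriv_of_isOpen (n := 1) hJ).1
      (by simpa [one_add_one_eq_two] using hc)).2.2.contDiffAt
        (hJ.mem_nhds hu)).differentiableAt (by norm_num)).hasDerivAt
  refine ⟨fun t => deriv c (s t), fun t ht => ?_⟩
  have hst := mem_image_of_mem s ht
  obtain ⟨hn, x, hx, hcx, hort⟩ := hcg _ hst
  have hxy : x = y t := by
    have h : graphMap f x = graphMap f (y t) := by rw [← hcx, ← hγc t ht, hγy t ht]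
    ext i
    fin_cases i
    · simpa [graphMap] using congrArg (fun z : Space => z 0) h
    · simpa [graphMap] using congrArg (fun z : Space => z 1) h
  subst hxy
  refine ⟨hn, ⟨deriv s t, hs0 t ht, ?_⟩, ?_⟩
  · have h1 := (hf.hasFDerivAt_graphMap hx).comp_hasDerivAt t (hy t ht)
    have h2 := (hc1 _ hst).scomp t (hsd t ht).hasDerivAt
    refine h1.unique (h2.congr_of_eventuallyEq ?_)
    filter_upwards [hI.mem_nhds ht] with τ hτ
    rw [Function.comp_apply, Function.comp_apply, ← hγy τ hτ, hγc τ hτ]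
  · have h2 := (hc2 _ hst).scomp t (hsd t ht).hasDerivAt
    rw [hf.eq_smul_graphNormal hx hort, smul_smul] at h2
    exact ⟨_, h2⟩

namespace IsParallelGeodesic

variable {f : Plane → ℝ} {D : Set Plane} (hf : IsConcavePatch f D) {r δ : ℝ} (hr : 0 < r)
  {y : ℝ → Plane} {w : ℝ → Space} (hy : IsParallelGeodesic f D r δ y w)
include hf hr hy

/-- If the projection preserves geodesics, then the unit tangent vectors of a geodesic of the
parallel surface and of its projection, being both parallel along the same field of normals, make a
constant angle. So a geodesic that starts in a principal direction is a line of curvature. -/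
theorem isPrincipal (hgeo : ProjectionPreservesGeodesics f D r)
    (h0 : IsPrincipal f (y 0) (w 0)) {t : ℝ} (ht : t ∈ Ioo (-δ) δ) :
    IsPrincipal f (y t) (w t) ∧
      fderiv ℝ (graphNormal f) (y t) (parallelInv f r (y t) (w t)) =
        parallelCurvature f r (y t) (w t) • w t := by
  obtain ⟨γ, hγ, hγg⟩ := hgeo _ _ isOpen_Ioo isPreconnected_Ioo (hy.isGeodesic hf hr.le)
  have hγy : ∀ t ∈ Ioo (-δ) δ, γ t = graphMap f (y t) := fun t ht => by
    have h := hf.graphMap_mem_nearestPoints (hy.mem t ht) hr.le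
    rw [hγ t ht] at h
    exact h.symm
  obtain ⟨T, hT⟩ := hγg.exists_unit_tangent hf isOpen_Ioo hy.hasDerivAt hγy
  have hTn : ∀ t ∈ Ioo (-δ) δ, inner ℝ (graphNormal f (y t)) (T t) = 0 := fun t ht => by
    obtain ⟨-, ⟨l, hl, hlT⟩, -⟩ := hT t ht
    have h := hf.inner_graphNormal_fderiv_graphMap (hy.mem t ht) (parallelInv f r (y t) (w t))
    rw [hlT, inner_smul_right] at h
    exact (mul_eq_zero.1 h).resolve_left hl
  have hconst : inner ℝ (T t) (w t) = inner ℝ (T 0) (w 0) := by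
    refine eq_of_hasDerivAt_zero_Ioo (g := fun t => (inner ℝ (T t) (w t) : ℝ)) (fun s hs => ?_) ht
    obtain ⟨-, -, μ, hμ⟩ := hT s hs
    refine (hμ.inner ℝ (hy.hasDerivAt_velocity s hs)).congr_deriv ?_
    rw [inner_smul_right, inner_smul_left, real_inner_comm, hTn s hs, hy.inner_eq s hs]
    simp
  have h00 : (0 : ℝ) ∈ Ioo (-δ) δ := by
    obtain ⟨h1, h2⟩ := ht
    constructor <;> linarith
  -- The projection multiplies a principal vector by `(1 + r k)⁻¹`, so it keeps its direction.
  have hstart : ∃ ε : ℝ, |ε| = 1 ∧ w 0 = ε • T 0 := by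
    obtain ⟨k, hk⟩ := h0.exists_eq
    obtain ⟨hT1, ⟨l, hl, hlT⟩, -⟩ := hT 0 h00
    have hD := hy.mem 0 h00
    set v := parallelInv f r (y 0) (w 0) with hv
    have e1 : horizontal (w 0) = (1 + r * k) • v := by
      refine hf.fderiv_parallel_injective hD hr.le ?_
      rw [map_smul, hv, hf.fderiv_parallelMap_parallelInv hD hr.le h0.inner_eq]
      simp only [add_apply, smul_apply]
      rw [hf.fderiv_graphMap_horizontal hD h0.inner_eq, hk]
      module
    have e2 : w 0 = ((1 + r * k) * l) • T 0 := by
      rw [mul_smul, ← hlT, ← map_smul, ← e1, hf.fderiv_graphMap_horizontal hD h0.inner_eq]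
    refine ⟨_, ?_, e2⟩
    have e3 := congrArg norm e2
    rw [norm_smul, hT1, h0.norm_eq, mul_one] at e3
    exact e3.symm
  obtain ⟨ε, hε, hw0⟩ := hstart
  have hεε : ε * ε = 1 := by rw [← abs_mul_abs_self, hε, one_mul]
  obtain ⟨hT1, ⟨l, hl, hlT⟩, -⟩ := hT t ht
  have hw : ε • T t = w t := by
    refine (inner_eq_one_iff_of_norm_eq_one (𝕜 := ℝ) ?_ (hy.norm_eq t ht)).1 ?_
    · rw [norm_smul, Real.norm_eq_abs, hε, hT1, one_mul]
    · rw [inner_smul_left, hconst, hw0, inner_smul_right, real_inner_self_eq_norm_sq,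
        (hT 0 h00).1]
      simpa using hεε
  have hD := hy.mem t ht
  set v := parallelInv f r (y t) (w t) with hv
  -- Now `dX v` and `dX v + r dn v` are both multiples of `w t`, and hence so is `dn v`.
  have hX : fderiv ℝ (graphMap f) (y t) v = (l * ε) • w t := by
    rw [hlT, ← hw, smul_smul, mul_assoc, hεε, mul_one]
  have hY := hf.fderiv_parallelMap_parallelInv hD hr.le (hy.inner_eq t ht)
  rw [← hv] at hY
  simp only [add_apply, smul_apply] at hY
  rw [hX] at hY
  have hN : fderiv ℝ (graphNormal f) (y t) v = (r⁻¹ * (1 - l * ε)) • w t := by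
    rw [mul_smul, sub_smul, one_smul]
    conv_rhs => rw [← hY]
    rw [hY, sub_eq_of_eq_add' hY.symm, smul_smul, inv_mul_cancel₀ hr.ne', one_smul]
  have hlε : l * ε ≠ 0 := by
    refine mul_ne_zero hl fun h => ?_
    simp [h] at hεε
  refine ⟨⟨hy.norm_eq t ht, hy.inner_eq t ht, (l * ε)⁻¹ * (r⁻¹ * (1 - l * ε)), ?_⟩, ?_⟩
  · have h1 : horizontal (w t) = (l * ε)⁻¹ • v := by
      rw [← hf.horizontal_fderiv_graphMap hD v, hX, map_smul, smul_smul, inv_mul_cancel₀ hlε,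
        one_smul]
    rw [h1, map_smul, hN, smul_smul]
  · rw [parallelCurvature, ← hv, hN, inner_smul_right, real_inner_self_eq_norm_sq,
      hy.norm_eq t ht]
    simp

end IsParallelGeodesic

/-! ### Lines of curvature as great circles -/

namespace IsConcavePatch

variable {f : Plane → ℝ} {D : Set Plane} (hf : IsConcavePatch f D)
include hf

/-- Where the Gauss map is immersive, the normal turns at a rate bounded below along lines of
curvature of the parallel surface. -/
theorem exists_le_parallelCurvature {r : ℝ} (hr : 0 ≤ r) {p : Plane} (hp : p ∈ D)
    (hinj : Function.Injective (fderiv ℝ (graphNormal f) p)) :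
    ∃ κ₀ > 0, ∀ᶠ x in 𝓝 p, ∀ u : Space, ‖u‖ = 1 → inner ℝ (graphNormal f x) u = 0 →
      fderiv ℝ (graphNormal f) x (parallelInv f r x u) = parallelCurvature f r x u • u →
        κ₀ ≤ parallelCurvature f r x u := by
  obtain ⟨K, hK, hKa⟩ := LinearMap.exists_antilipschitzWith
    (fderiv ℝ (graphNormal f) p : Plane →ₗ[ℝ] Space) (LinearMap.ker_eq_bot.2 hinj)
  have hK' : (0 : ℝ) < K := hK
  have hDp := hf.isOpen.mem_nhds hp
  set A : Plane → Plane →L[ℝ] Space :=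
    fun x => fderiv ℝ (graphMap f) x + r • fderiv ℝ (graphNormal f) x
  have hN : ContinuousAt (fderiv ℝ (graphNormal f)) p :=
    hf.continuousOn_fderiv_graphNormal.continuousAt hDp
  have hA : ContinuousAt A p :=
    (hf.continuousOn_fderiv_graphMap.continuousAt hDp).add (hN.const_smul r)
  have hB : 0 < ‖A p‖ + 1 := by positivity
  refine ⟨(2 * K * (‖A p‖ + 1))⁻¹, by positivity, ?_⟩
  have h1 : ∀ᶠ x in 𝓝 p, ‖A x‖ < ‖A p‖ + 1 :=
    hA.norm.eventually (gt_mem_nhds (lt_add_one _))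
  have h2 : ∀ᶠ x in 𝓝 p,
      ‖fderiv ℝ (graphNormal f) p - fderiv ℝ (graphNormal f) x‖ < (2 * K : ℝ)⁻¹ := by
    have h := (continuousAt_const.sub hN).norm (f := fun x =>
      fderiv ℝ (graphNormal f) p - fderiv ℝ (graphNormal f) x)
    refine h.eventually (gt_mem_nhds ?_)
    simp only [sub_self, norm_zero]
    positivity
  filter_upwards [h1, h2, hDp] with x hx1 hx2 hxD u hu hxu hκ
  have hAv := hf.fderiv_parallelMap_parallelInv hxD hr hxu
  set v := parallelInv f r x u with hv
  -- By convexity `⟪u, dn v⟫ = ⟪dX v, dn v⟫ + r ‖dn v‖² ≥ 0`.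
  have hκ0 : 0 ≤ parallelCurvature f r x u := by
    rw [parallelCurvature, ← hv]
    conv_rhs => rw [← hAv]
    simp only [add_apply, smul_apply]
    rw [inner_add_left, real_inner_smul_left, real_inner_comm]
    refine add_nonneg (hf.secondForm_self_nonneg hxD v) (mul_nonneg hr real_inner_self_nonneg)
  have e1 : 1 ≤ (‖A p‖ + 1) * ‖v‖ := by
    refine (show (1 : ℝ) = ‖A x v‖ by rw [← hu]; exact congrArg norm hAv.symm).trans_le ?_
    exact ((A x).le_opNorm v).trans (mul_le_mul_of_nonneg_right hx1.le (norm_nonneg _))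
  have e2 : ‖v‖ ≤ K * ‖fderiv ℝ (graphNormal f) p v‖ := by
    simpa using hKa.le_mul_dist v 0
  have e3 : ‖fderiv ℝ (graphNormal f) p v‖
      ≤ ‖fderiv ℝ (graphNormal f) x v‖ + (2 * K : ℝ)⁻¹ * ‖v‖ := by
    refine (norm_le_norm_add_norm_sub' _ (fderiv ℝ (graphNormal f) x v)).trans ?_
    gcongr
    rw [← sub_apply]
    exact (ContinuousLinearMap.le_opNorm _ v).trans
      (mul_le_mul_of_nonneg_right hx2.le (norm_nonneg _))
  have e4 : ‖fderiv ℝ (graphNormal f) x v‖ = parallelCurvature f r x u := by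
    rw [hκ, norm_smul, hu, mul_one, Real.norm_eq_abs, abs_of_nonneg hκ0]
  rw [e4] at e3
  have e5 : ‖v‖ ≤ 2 * K * parallelCurvature f r x u := by
    have e6 := e2.trans (mul_le_mul_of_nonneg_left e3 hK'.le)
    have e7 : (K : ℝ) * (parallelCurvature f r x u + (2 * K : ℝ)⁻¹ * ‖v‖)
        = K * parallelCurvature f r x u + ‖v‖ / 2 := by
      field_simp
    linarith
  rw [inv_le_iff_one_le_mul₀ (by positivity)]
  nlinarith [mul_le_mul_of_nonneg_left e5 hB.le]

/-- If the projection preserves geodesics, then near a point where the Gauss map is immersive the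
Gauss map takes lines of curvature to great circles; the arcs through the images of nearby points
have a length bounded below. -/
theorem exists_great_circle {r : ℝ} (hr : 0 < r) (hgeo : ProjectionPreservesGeodesics f D r)
    {p : Plane} (hp : p ∈ D) (hinj : Function.Injective (fderiv ℝ (graphNormal f) p))
    {V : Set Plane} (hV : V ∈ 𝓝 p) :
    ∃ V₁ ∈ 𝓝 p, ∃ δ > 0, ∀ x ∈ V₁, ∀ u, IsPrincipal f x u → ∀ θ : ℝ, |θ| < δ → ∃ z ∈ V,
      graphNormal f z = Real.cos θ • graphNormal f x + Real.sin θ • u ∧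
        IsPrincipal f z (Real.cos θ • u - Real.sin θ • graphNormal f x) := by
  obtain ⟨κ₀, hκ₀, hlow⟩ := hf.exists_le_parallelCurvature hr.le hp hinj
  obtain ⟨V₁, hV₁, δ, hδ, hex⟩ := hf.exists_isParallelGeodesic hr.le hp (inter_mem hV hlow)
  refine ⟨V₁, hV₁, κ₀ * δ, by positivity, fun x hx u hu θ hθ => ?_⟩
  obtain ⟨y, w, hy0, hw0, hy, hyV⟩ := hex x hx u hu.norm_eq hu.inner_eq
  have hpr := fun t (ht : t ∈ Ioo (-δ) δ) =>
    hy.isPrincipal hf hr hgeo (by rwa [hy0, hw0]) ht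
  set κ : ℝ → ℝ := fun t => parallelCurvature f r (y t) (w t)
  have hκle : ∀ t ∈ Ioo (-δ) δ, κ₀ ≤ κ t := fun t ht =>
    (hyV t ht).2 _ (hy.norm_eq t ht) (hy.inner_eq t ht) (hpr t ht).2
  have hκc : ContinuousOn κ (Ioo (-δ) δ) := hy.continuousOn_curvature hf hr.le
  have h00 : (0 : ℝ) ∈ Ioo (-δ) δ := ⟨by linarith, hδ⟩
  -- The angle by which the normal has turned.
  let Θ : ℝ → ℝ := fun t => ∫ s in (0 : ℝ)..t, κ s
  have hΘ0 : Θ 0 = 0 := by simp [Θ]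
  have hΘ : ∀ t ∈ Ioo (-δ) δ, HasDerivAt Θ (κ t) t := fun t ht => by
    have hsub : uIcc 0 t ⊆ Ioo (-δ) δ := ordConnected_Ioo.uIcc_subset h00 ht
    exact intervalIntegral.integral_hasDerivAt_right (hκc.mono hsub).intervalIntegrable
      (hκc.stronglyMeasurableAtFilter isOpen_Ioo t ht) (hκc.continuousAt (Ioo_mem_nhds ht.1 ht.2))
  have hn : ∀ t ∈ Ioo (-δ) δ, HasDerivAt (fun t => graphNormal f (y t)) (κ t • w t) t :=
    fun t ht => by
      rw [← (hpr t ht).2]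
      exact (hf.hasFDerivAt_graphNormal (hy.mem t ht)).comp_hasDerivAt t (hy.hasDerivAt t ht)
  -- Rotating the frame `(n, w)` back by this angle gives constant vectors.
  have hA : ∀ t ∈ Ioo (-δ) δ,
      Real.cos (Θ t) • graphNormal f (y t) - Real.sin (Θ t) • w t = graphNormal f x := fun t ht => by
    have h := eq_of_hasDerivAt_zero_Ioo (g := fun t =>
      Real.cos (Θ t) • graphNormal f (y t) - Real.sin (Θ t) • w t) (fun s hs => ?_) ht
    · simpa [hΘ0, hy0] using h
    · refine (((hΘ s hs).cos.smul (hn s hs)).sub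
        ((hΘ s hs).sin.smul (hy.hasDerivAt_velocity s hs))).congr_deriv ?_
      change _ • κ s • _ + _ - (_ • -κ s • _ + _) = _
      module
  have hB : ∀ t ∈ Ioo (-δ) δ,
      Real.sin (Θ t) • graphNormal f (y t) + Real.cos (Θ t) • w t = u := fun t ht => by
    have h := eq_of_hasDerivAt_zero_Ioo (g := fun t =>
      Real.sin (Θ t) • graphNormal f (y t) + Real.cos (Θ t) • w t) (fun s hs => ?_) ht
    · simpa [hΘ0, hw0] using h
    · refine (((hΘ s hs).sin.smul (hn s hs)).add
        ((hΘ s hs).cos.smul (hy.hasDerivAt_velocity s hs))).congr_deriv ?_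
      change _ • κ s • _ + _ + (_ • -κ s • _ + _) = _
      module
  -- The angle attains the value `θ`, since it grows at a rate at least `κ₀`.
  obtain ⟨t, ht, htθ⟩ : ∃ t ∈ Ioo (-δ) δ, Θ t = θ := by
    set b := |θ| / κ₀
    have hb0 : 0 ≤ b := by positivity
    have hbδ : b < δ := by rw [div_lt_iff₀ hκ₀]; linarith
    have hIcc : Icc (-b) b ⊆ Ioo (-δ) δ := Icc_subset_Ioo (by linarith) hbδ
    have hc : ContinuousOn Θ (Icc (-b) b) := fun t ht =>
      (hΘ t (hIcc ht)).continuousAt.continuousWithinAt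
    have hmono := (convex_Icc (-b) b).mul_sub_le_image_sub_of_le_deriv hc
      (fun t ht => (hΘ t (hIcc (interior_subset ht))).differentiableAt.differentiableWithinAt)
      (C := κ₀) (fun t ht => by
        rw [(hΘ t (hIcc (interior_subset ht))).deriv]
        exact hκle t (hIcc (interior_subset ht)))
    have hbκ : κ₀ * b = |θ| := by simp only [b]; field_simp
    have hm0 : (0 : ℝ) ∈ Icc (-b) b := ⟨by linarith, hb0⟩
    have h1 := hmono 0 hm0 b ⟨by linarith, le_rfl⟩ hb0
    have h2 := hmono (-b) ⟨le_rfl, by linarith⟩ 0 hm0 (by linarith)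
    rw [hΘ0] at h1 h2
    have h3 := abs_le.1 (le_refl |θ|)
    obtain ⟨t, ht, h⟩ := intermediate_value_Icc (by linarith : -b ≤ b) hc
      (show θ ∈ Icc (Θ (-b)) (Θ b) from ⟨by linarith, by linarith⟩)
    exact ⟨t, hIcc ht, h⟩
  have eA := hA t ht
  have eB := hB t ht
  rw [htθ] at eA eB
  have hcs : Real.cos θ * Real.cos θ + Real.sin θ * Real.sin θ = 1 := by
    nlinarith [Real.sin_sq_add_cos_sq θ]
  refine ⟨y t, (hyV t ht).1, ?_, ?_⟩
  · rw [← eA, ← eB]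
    linear_combination (norm := module) (-hcs) • graphNormal f (y t)
  · convert (hpr t ht).1 using 1
    rw [← eA, ← eB]
    linear_combination (norm := module) hcs • w t

end IsConcavePatch

/-! ### Principal directions and umbilics -/

theorem exists_unit_orthogonal (a b : Space) :
    ∃ w : Space, ‖w‖ = 1 ∧ inner ℝ a w = 0 ∧ inner ℝ b w = 0 := by
  have h := LinearMap.ker_ne_bot_of_finrank_lt (K := ℝ)
    (f := ((innerSL ℝ a).prod (innerSL ℝ b) : Space →ₗ[ℝ] ℝ × ℝ)) (by simp)
  obtain ⟨w, hw, hw0⟩ := (Submodule.ne_bot_iff _).1 h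
  have hw' : inner ℝ a w = 0 ∧ inner ℝ b w = 0 := by simpa using hw
  refine ⟨‖w‖⁻¹ • w, ?_, ?_, ?_⟩
  · rw [norm_smul, norm_inv, norm_norm, inv_mul_cancel₀ (norm_ne_zero_iff.2 hw0)]
  · rw [inner_smul_right, hw'.1, mul_zero]
  · rw [inner_smul_right, hw'.2, mul_zero]

/-- Expansion of a vector in an orthonormal frame of space. -/
theorem eq_sum_orthonormal {n u w : Space} (hn : ‖n‖ = 1) (hu : ‖u‖ = 1) (hw : ‖w‖ = 1)
    (hnu : inner ℝ n u = 0) (hnw : inner ℝ n w = 0) (huw : inner ℝ u w = 0) (v : Space) :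
    v = (inner ℝ n v : ℝ) • n + (inner ℝ u v : ℝ) • u + (inner ℝ w v : ℝ) • w := by
  have ho : Orthonormal ℝ ![n, u, w] := by
    refine ⟨fun i => by fin_cases i <;> simpa, fun i j hij => ?_⟩
    fin_cases i <;> fin_cases j <;> first | exact absurd rfl hij | simpa using by assumption | skip
    all_goals simp only [Matrix.cons_val, Fin.mk_zero, Fin.mk_one, Fin.reduceFinMk]
    all_goals rw [real_inner_comm]; assumption
  have hs := ho.linearIndependent.span_eq_top_of_card_eq_finrank' (by simp)
  have h := (OrthonormalBasis.mk ho hs.ge).sum_repr' v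
  simpa [Fin.sum_univ_three, eq_comm] using h

namespace IsConcavePatch

variable {f : Plane → ℝ} {D : Set Plane} (hf : IsConcavePatch f D) {x : Plane} (hx : x ∈ D)
include hf hx

/-- The shape operator is symmetric on the tangent plane. -/
theorem inner_shape_comm {u w : Space} (hu : inner ℝ (graphNormal f x) u = 0)
    (hw : inner ℝ (graphNormal f x) w = 0) :
    inner ℝ u (fderiv ℝ (graphNormal f) x (horizontal w)) =
      (inner ℝ w (fderiv ℝ (graphNormal f) x (horizontal u)) : ℝ) := by
  have h := hf.secondForm_comm hx (horizontal w) (horizontal u)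
  rw [secondForm, secondForm, hf.fderiv_graphMap_horizontal hx hu,
    hf.fderiv_graphMap_horizontal hx hw] at h
  rw [real_inner_comm, h, real_inner_comm]

theorem isPrincipal_of_conjugate {u w : Space} (hu : ‖u‖ = 1) (hw : ‖w‖ = 1)
    (hnu : inner ℝ (graphNormal f x) u = 0) (hnw : inner ℝ (graphNormal f x) w = 0)
    (huw : inner ℝ u w = 0)
    (h : inner ℝ u (fderiv ℝ (graphNormal f) x (horizontal w)) = 0) : IsPrincipal f x w := by
  refine ⟨hw, hnw, inner ℝ w (fderiv ℝ (graphNormal f) x (horizontal w)), ?_⟩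
  have h1 := eq_sum_orthonormal (norm_graphNormal f x) hu hw hnu hnw huw
    (fderiv ℝ (graphNormal f) x (horizontal w))
  rw [hf.inner_graphNormal_fderiv_graphNormal hx, h, zero_smul, zero_smul, zero_add, zero_add] at h1
  exact h1

/-- The tangent vectors orthogonal to a principal direction are principal. -/
theorem isPrincipal_of_orthogonal {u w : Space} (hu : IsPrincipal f x u) (hw : ‖w‖ = 1)
    (hnw : inner ℝ (graphNormal f x) w = 0) (huw : inner ℝ u w = 0) : IsPrincipal f x w := by
  refine hf.isPrincipal_of_conjugate hx hu.norm_eq hw hu.inner_eq hnw huw ?_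
  obtain ⟨k, hk⟩ := hu.exists_eq
  rw [hf.inner_shape_comm hx hu.inner_eq hnw, hk, inner_smul_right, real_inner_comm, huw, mul_zero]

/-- Principal directions exist: the second fundamental form of a rotating orthonormal frame of the
tangent plane changes sign during a quarter turn. -/
theorem exists_isPrincipal : ∃ u, IsPrincipal f x u := by
  set n := graphNormal f x with hn
  obtain ⟨a, ha, hna, -⟩ := exists_unit_orthogonal n n
  obtain ⟨b, hb, hnb, hab⟩ := exists_unit_orthogonal n a
  let u : ℝ → Space := fun θ => Real.cos θ • a + Real.sin θ • b
  let w : ℝ → Space := fun θ => -Real.sin θ • a + Real.cos θ • b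
  let g : ℝ → ℝ := fun θ => inner ℝ (u θ) (fderiv ℝ (graphNormal f) x (horizontal (w θ)))
  have hg : Continuous g := by simp only [g, u, w]; fun_prop
  have hg0 : g 0 = inner ℝ a (fderiv ℝ (graphNormal f) x (horizontal b)) := by simp [g, u, w]
  have hg1 : g (Real.pi / 2) = -g 0 := by
    rw [hg0, hf.inner_shape_comm hx hna hnb]
    simp [g, u, w]
  obtain ⟨θ, -, hθ⟩ := intermediate_value_uIcc (a := 0) (b := Real.pi / 2) hg.continuousOn
    (show (0 : ℝ) ∈ uIcc (g 0) (g (Real.pi / 2)) by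
      rw [hg1, mem_uIcc]
      rcases le_total (g 0) 0 with h | h
      · exact Or.inl ⟨h, by linarith⟩
      · exact Or.inr ⟨by linarith, h⟩)
  have hba : inner ℝ b a = (0 : ℝ) := by rw [real_inner_comm]; exact hab
  have haa : inner ℝ a a = (1 : ℝ) := by rw [real_inner_self_eq_norm_sq, ha]; norm_num
  have hbb : inner ℝ b b = (1 : ℝ) := by rw [real_inner_self_eq_norm_sq, hb]; norm_num
  have hcs := Real.sin_sq_add_cos_sq θ
  have hunit : ∀ v : Space, inner ℝ v v = (1 : ℝ) → ‖v‖ = 1 := fun v hv => by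
    rw [real_inner_self_eq_norm_sq] at hv
    exact (pow_eq_one_iff_of_nonneg (norm_nonneg v) two_ne_zero).1 hv
  refine ⟨w θ, hf.isPrincipal_of_conjugate hx (u := u θ) (hunit _ ?_) (hunit _ ?_) ?_ ?_ ?_ hθ⟩
  all_goals simp only [u, w, inner_add_left, inner_add_right, inner_smul_left, inner_smul_right,
    ← hn, hna, hnb, hab, hba, haa, hbb, RCLike.conj_to_real]
  all_goals nlinarith

end IsConcavePatch

/-- Two principal directions that are neither orthogonal nor parallel only exist at an umbilic. -/
theorem IsPrincipal.isUmbilic {f : Plane → ℝ} {D : Set Plane} (hf : IsConcavePatch f D) {x : Plane}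
    (hx : x ∈ D) {u w : Space} (hu : IsPrincipal f x u) (hw : IsPrincipal f x w)
    (h0 : (inner ℝ u w : ℝ) ≠ 0) (h1 : (inner ℝ u w : ℝ) ^ 2 ≠ 1) : IsUmbilic f x := by
  obtain ⟨k, hk⟩ := hu.exists_eq
  obtain ⟨l, hl⟩ := hw.exists_eq
  have hkl : l = k := by
    have h := hf.inner_shape_comm hx hu.inner_eq hw.inner_eq
    rw [hk, hl, inner_smul_right, inner_smul_right, real_inner_comm u w] at h
    exact mul_right_cancel₀ h0 h
  subst hkl
  obtain ⟨e, he, hne, hue⟩ := exists_unit_orthogonal (graphNormal f x) u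
  have hew := eq_sum_orthonormal (norm_graphNormal f x) hu.norm_eq he hu.inner_eq hne hue w
  rw [hw.inner_eq, zero_smul, zero_add] at hew
  set a : ℝ := inner ℝ u w
  set b : ℝ := inner ℝ e w
  have hb : b ≠ 0 := fun hb => by
    rw [hb, zero_smul, add_zero] at hew
    have h2 := congrArg norm hew
    rw [norm_smul, hu.norm_eq, hw.norm_eq, Real.norm_eq_abs, mul_one] at h2
    exact h1 (by rw [← sq_abs, ← h2, one_pow])
  have hke : fderiv ℝ (graphNormal f) x (horizontal e) = l • e := by
    have e1 : e = b⁻¹ • (w - a • u) := by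
      rw [hew, add_sub_cancel_left, smul_smul, inv_mul_cancel₀ hb, one_smul]
    rw [e1]
    simp only [map_smul, map_sub, hk, hl]
    module
  refine ⟨l, fun v v' => ?_⟩
  have hv := eq_sum_orthonormal (norm_graphNormal f x) hu.norm_eq he hu.inner_eq hne hue
    (fderiv ℝ (graphMap f) x v)
  rw [hf.inner_graphNormal_fderiv_graphMap hx, zero_smul, zero_add] at hv
  have hS : fderiv ℝ (graphNormal f) x v = l • fderiv ℝ (graphMap f) x v := by
    conv_lhs => rw [← hf.horizontal_fderiv_graphMap hx v, hv]
    conv_rhs => rw [hv]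
    simp only [map_add, map_smul, hk, hke]
    module
  rw [secondForm, firstForm, hS, real_inner_smul_left]

namespace IsConcavePatch

variable {f : Plane → ℝ} {D : Set Plane} (hf : IsConcavePatch f D)
include hf

theorem continuousOn_firstForm (v w : Plane) : ContinuousOn (fun x => firstForm f x v w) D :=
  (hf.continuousOn_fderiv_graphMap.clm_apply continuousOn_const).inner (𝕜 := ℝ)
    (hf.continuousOn_fderiv_graphMap.clm_apply continuousOn_const)

theorem continuousOn_secondForm (v w : Plane) : ContinuousOn (fun x => secondForm f x v w) D :=
  (hf.continuousOn_fderiv_graphNormal.clm_apply continuousOn_const).inner (𝕜 := ℝ)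
    (hf.continuousOn_fderiv_graphMap.clm_apply continuousOn_const)

theorem firstForm_self_pos {x : Plane} (hx : x ∈ D) {v : Plane} (hv : v ≠ 0) :
    0 < firstForm f x v v := by
  rw [firstForm, real_inner_self_eq_norm_sq]
  have h : fderiv ℝ (graphMap f) x v ≠ 0 := fun h => hv (by
    rw [← hf.horizontal_fderiv_graphMap hx v, h, map_zero])
  positivity

theorem eventually_not_isUmbilic {p : Plane} (hp : p ∈ D) (h : ¬IsUmbilic f p) :
    ∀ᶠ x in 𝓝 p, ¬IsUmbilic f x := by
  let e : Plane := EuclideanSpace.single 0 1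
  have he : e ≠ 0 := by simp [e]
  have hE := hf.firstForm_self_pos hp he
  obtain ⟨v, w, hvw⟩ : ∃ v w, secondForm f p v w * firstForm f p e e
      - secondForm f p e e * firstForm f p v w ≠ 0 := by
    by_contra! hc
    refine h ⟨secondForm f p e e / firstForm f p e e, fun v w => ?_⟩
    have := hc v w
    field_simp
    linarith
  have hDp := hf.isOpen.mem_nhds hp
  have hc := (((hf.continuousOn_secondForm v w).mul (hf.continuousOn_firstForm e e)).sub
    ((hf.continuousOn_secondForm e e).mul (hf.continuousOn_firstForm v w))).continuousAt hDp
  filter_upwards [hc.eventually_ne hvw] with x hx hu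
  obtain ⟨k, hk⟩ := hu
  refine hx ?_
  simp only [Pi.sub_apply, Pi.mul_apply, hk]
  ring

theorem exists_injOn_graphNormal {p : Plane} (hp : p ∈ D)
    (hinj : Function.Injective (fderiv ℝ (graphNormal f) p)) :
    ∃ V ∈ 𝓝 p, InjOn (graphNormal f) V := by
  obtain ⟨K, hK, hKa⟩ := LinearMap.exists_antilipschitzWith
    (fderiv ℝ (graphNormal f) p : Plane →ₗ[ℝ] Space) (LinearMap.ker_eq_bot.2 hinj)
  have hK' : (0 : ℝ) < K := hK
  have hs := (hf.contDiffOn_graphNormal.contDiffAt (hf.isOpen.mem_nhds hp)).hasStrictFDerivAt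
    (by norm_num)
  obtain ⟨V, hV, hVa⟩ := hs.approximates_deriv_on_nhds (c := (2 * K)⁻¹)
    (Or.inr (by positivity))
  refine ⟨V, hV, fun x hx y hy hxy => ?_⟩
  have h1 := hVa x hx y hy
  rw [hxy, sub_self, zero_sub, norm_neg] at h1
  have h2 : ‖x - y‖ ≤ K * ‖fderiv ℝ (graphNormal f) p (x - y)‖ := by
    simpa using hKa.le_mul_dist (x - y) 0
  have h3 := h2.trans (mul_le_mul_of_nonneg_left h1 hK'.le)
  push_cast at h3
  have h4 : (K : ℝ) * ((2 * (K : ℝ))⁻¹ * ‖x - y‖) = ‖x - y‖ / 2 := by field_simp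
  have h5 := norm_nonneg (x - y)
  exact sub_eq_zero.1 (norm_eq_zero.1 (by linarith))

end IsConcavePatch

/-! ### Orthogonal nets of great circles -/

namespace IsConcavePatch

variable {f : Plane → ℝ} {D : Set Plane} (hf : IsConcavePatch f D)
include hf

/-- The great circle through `n x` in the direction `u`, parametrized by central projection. -/
theorem exists_great_circle_projective {r : ℝ} (hr : 0 < r)
    (hgeo : ProjectionPreservesGeodesics f D r) {p : Plane} (hp : p ∈ D)
    (hinj : Function.Injective (fderiv ℝ (graphNormal f) p)) {V : Set Plane} (hV : V ∈ 𝓝 p) :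
    ∃ V₁ ∈ 𝓝 p, ∃ δ > 0, ∀ x ∈ V₁, ∀ u, IsPrincipal f x u → ∀ t : ℝ, 0 < t → t < δ → ∃ z ∈ V,
      graphNormal f z = (√(1 + t ^ 2))⁻¹ • (graphNormal f x + t • u) ∧
        IsPrincipal f z ((√(1 + t ^ 2))⁻¹ • (u - t • graphNormal f x)) := by
  obtain ⟨V₁, hV₁, δ, hδ, h⟩ := hf.exists_great_circle hr hgeo hp hinj hV
  refine ⟨V₁, hV₁, δ, hδ, fun x hx u hu t ht htδ => ?_⟩
  have ha : 0 ≤ Real.arctan t := Real.arctan_nonneg.2 ht.le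
  have hb : Real.arctan t ≤ t := by
    have := Real.le_tan ha (Real.arctan_lt_pi_div_two t)
    rwa [Real.tan_arctan] at this
  obtain ⟨z, hz, h1, h2⟩ := h x hx u hu (Real.arctan t) (by rw [abs_of_nonneg ha]; linarith)
  rw [Real.cos_arctan, Real.sin_arctan] at h1 h2
  refine ⟨z, hz, ?_, ?_⟩
  · rw [h1]; module
  · convert h2 using 1; module

/-- If the projection preserves geodesics, then every point where the Gauss map is immersive is an
umbilic. Otherwise the two families of lines of curvature near the point would be mapped by the
Gauss map to two orthogonal families of great circles, which do not exist: following a first arc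
and then the arc orthogonal to it, in either order, leads to the same point of the sphere, but the
two directions of arrival are neither parallel nor orthogonal. -/
theorem isUmbilic_of_injective {r : ℝ} (hr : 0 < r)
    (hgeo : ProjectionPreservesGeodesics f D r) {p : Plane} (hp : p ∈ D)
    (hinj : Function.Injective (fderiv ℝ (graphNormal f) p)) : IsUmbilic f p := by
  by_contra hnu
  obtain ⟨W, hW, hWinj⟩ := hf.exists_injOn_graphNormal hp hinj
  have hV₀ := inter_mem (inter_mem hW (hf.eventually_not_isUmbilic hp hnu))
    (hf.isOpen.mem_nhds hp)
  obtain ⟨V₁, hV₁, δ₁, hδ₁, h₁⟩ := hf.exists_great_circle_projective hr hgeo hp hinj hV₀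
  obtain ⟨V₂, hV₂, δ₂, hδ₂, h₂⟩ := hf.exists_great_circle_projective hr hgeo hp hinj
    (inter_mem hV₁ (hf.isOpen.mem_nhds hp))
  obtain ⟨ε, hε, hε₁, hε₂, hε3⟩ : ∃ ε : ℝ, 0 < ε ∧ ε < δ₁ ∧ ε < δ₂ ∧ ε < 1 / 2 := by
    obtain ⟨ε, h0, h⟩ := exists_between (lt_min hδ₁ (lt_min hδ₂ (by norm_num : (0 : ℝ) < 1 / 2)))
    simp only [lt_min_iff] at h
    exact ⟨ε, h0, h.1, h.2.1, h.2.2⟩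
  set n := graphNormal f p with hn
  set ρ : ℝ := (√(1 + ε ^ 2))⁻¹ with hρ
  have hρ2 : ρ ^ 2 * (1 + ε ^ 2) = 1 := by
    rw [hρ, inv_pow, Real.sq_sqrt (by positivity), inv_mul_cancel₀ (by positivity)]
  have hρ0 : 0 < ρ := by positivity
  have hρ1 : ρ ^ 2 ≤ 1 := by nlinarith [mul_nonneg (sq_nonneg ρ) (sq_nonneg ε)]
  have hρ1' : ρ ≤ 1 := by nlinarith
  -- The arc in the direction `u`, followed by the orthogonal arc towards the pole `w` of the first;
  -- the length `ε * ρ` of the second makes the end point symmetric in `u` and `w`.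
  have key : ∀ u w, IsPrincipal f p u → IsPrincipal f p w → inner ℝ u w = (0 : ℝ) →
      ∃ z ∈ W ∩ {x | ¬IsUmbilic f x} ∩ D,
        graphNormal f z = ((√(1 + (ε * ρ) ^ 2))⁻¹ * ρ) • (n + ε • u + ε • w) ∧
        IsPrincipal f z ((√(1 + (ε * ρ) ^ 2))⁻¹ • (w - (ε * ρ ^ 2) • (n + ε • u))) := by
    intro u w hu hw huw
    obtain ⟨x, ⟨hxV, hxD⟩, hx, hxu⟩ := h₂ p (mem_of_mem_nhds hV₂) u hu ε hε hε₂
    have hxw : IsPrincipal f x w := by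
      refine hf.isPrincipal_of_orthogonal hxD hxu hw.norm_eq ?_ ?_
      · rw [hx, inner_smul_left, inner_add_left, inner_smul_left, huw, hw.inner_eq]; simp
      · rw [inner_smul_left, inner_sub_left, inner_smul_left, huw, hw.inner_eq]; simp
    obtain ⟨z, hz, hzn, hzw⟩ := h₁ x hxV w hxw (ε * ρ) (by positivity) (by nlinarith)
    rw [hx] at hzn hzw
    refine ⟨z, hz, ?_, ?_⟩
    · rw [hzn]; module
    · convert hzw using 2; module
  obtain ⟨u, hu⟩ := hf.exists_isPrincipal hp
  obtain ⟨w, hw1, hnw, huw⟩ := exists_unit_orthogonal n u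
  have hw := hf.isPrincipal_of_orthogonal hp hu hw1 hnw huw
  have hwu : inner ℝ w u = (0 : ℝ) := by rw [real_inner_comm]; exact huw
  obtain ⟨z, hz, hzn, hzw⟩ := key u w hu hw huw
  obtain ⟨z', hz', hzn', hzu⟩ := key w u hw hu hwu
  have hzz : z' = z := hWinj hz'.1.1 hz.1.1 (by rw [hzn, hzn']; module)
  subst hzz
  set σ : ℝ := (√(1 + (ε * ρ) ^ 2))⁻¹ with hσ
  have hσ0 : 0 < σ := by positivity
  have hσ2 : σ ^ 2 ≤ 1 := by
    rw [hσ, inv_pow, Real.sq_sqrt (by positivity)]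
    exact inv_le_one_of_one_le₀ (by nlinarith [sq_nonneg (ε * ρ)])
  have hip : (inner ℝ (σ • (w - (ε * ρ ^ 2) • (n + ε • u)))
      (σ • (u - (ε * ρ ^ 2) • (n + ε • w))) : ℝ) = σ ^ 2 * (ε ^ 2 * ρ ^ 2 * (ρ ^ 2 - 2)) := by
    have hun : inner ℝ u n = (0 : ℝ) := by rw [real_inner_comm]; exact hu.inner_eq
    have hwn : inner ℝ w n = (0 : ℝ) := by rw [real_inner_comm]; exact hnw
    have hnu : inner ℝ n u = (0 : ℝ) := hu.inner_eq
    have hnn : inner ℝ n n = (1 : ℝ) := by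
      rw [real_inner_self_eq_norm_sq, norm_graphNormal]; norm_num
    have huu : inner ℝ u u = (1 : ℝ) := by rw [real_inner_self_eq_norm_sq, hu.norm_eq]; norm_num
    have hww : inner ℝ w w = (1 : ℝ) := by rw [real_inner_self_eq_norm_sq, hw1]; norm_num
    simp only [inner_add_left, inner_add_right, inner_sub_left, inner_sub_right, inner_smul_left,
      inner_smul_right, hun, hwn, hnu, hnw, hnn, huu, hww, huw, hwu, RCLike.conj_to_real]
    ring
  have hc : 0 < ε ^ 2 * ρ ^ 2 * (2 - ρ ^ 2) := mul_pos (by positivity) (by linarith)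
  have hc1 : ε ^ 2 * ρ ^ 2 * (2 - ρ ^ 2) < 1 := by
    have h1 : ε ^ 2 < 1 / 4 := by nlinarith
    have h2 : ε ^ 2 * ρ ^ 2 ≤ 1 / 4 := by nlinarith [sq_nonneg ρ]
    nlinarith [sq_nonneg ρ]
  refine hz.1.2 (hzw.isUmbilic hf hz.2 hzu ?_ ?_)
  · rw [hip]
    refine mul_ne_zero (by positivity) ?_
    intro h
    linarith
  · rw [hip]
    set c := ε ^ 2 * ρ ^ 2 * (2 - ρ ^ 2)
    rw [show σ ^ 2 * (ε ^ 2 * ρ ^ 2 * (ρ ^ 2 - 2)) = -(σ ^ 2 * c) by simp only [c]; ring, neg_sq]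
    have h1 : σ ^ 2 * c < 1 := by nlinarith
    have h2 : 0 < σ ^ 2 * c := by positivity
    intro h
    nlinarith

end IsConcavePatch

/-! ### Global alternative -/

/-- Concavity on the convex hull is only used through the tangent planes over `D`. -/
theorem ConcaveOn.isConcavePatch {f : Plane → ℝ} {D : Set Plane} (hD : IsOpen D)
    (hf : ContDiffOn ℝ 2 f D) (hc : ConcaveOn ℝ (convexHull ℝ D) f) : IsConcavePatch f D := by
  refine ⟨hD, hf, fun x hx y hy => ?_⟩
  have hfx : HasFDerivAt f (fderiv ℝ f x) x :=
    ((hf.contDiffAt (hD.mem_nhds hx)).differentiableAt (by norm_num)).hasFDerivAt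
  have hl : HasDerivAt (fun t : ℝ => x + t • (y - x)) (y - x) 0 := by
    simpa using ((hasDerivAt_id (0 : ℝ)).smul_const (y - x)).const_add x
  have h1 : HasDerivAt (fun t : ℝ => f (x + t • (y - x))) (fderiv ℝ f x (y - x)) 0 :=
    HasFDerivAt.comp_hasDerivAt (0 : ℝ) (by simpa using hfx) hl
  have h2 := (hasDerivAt_iff_tendsto_slope.1 h1).mono_left (nhdsGT_le_nhdsNE 0)
  suffices f y - f x ≤ fderiv ℝ f x (y - x) by linarith
  refine ge_of_tendsto h2 ?_
  filter_upwards [Ioo_mem_nhdsGT (zero_lt_one (α := ℝ))] with t ht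
  have h3 := hc.2 (subset_convexHull ℝ D hx) (subset_convexHull ℝ D hy)
    (sub_nonneg.2 ht.2.le) ht.1.le (sub_add_cancel 1 t)
  rw [show (1 - t) • x + t • y = x + t • (y - x) by module] at h3
  simp only [smul_eq_mul] at h3
  rw [slope_def_field, le_div_iff₀ (by linarith [ht.1])]
  simp only [zero_smul, add_zero, sub_zero]
  linarith

theorem injective_fderiv_graphNormal {f : Plane → ℝ} {x : Plane} (hK : gaussCurvature f x ≠ 0) :
    Function.Injective (fderiv ℝ (graphNormal f) x) := by
  rw [injective_iff_map_eq_zero]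
  intro v hv
  have hdet := (div_ne_zero_iff.1 hK).1
  have hz : ∀ w, secondForm f x v w = 0 := fun w => by rw [secondForm, hv, inner_zero_left]
  have hlin : ∀ w, secondForm f x v w = v 0 * secondForm f x (EuclideanSpace.single 0 1) w
      + v 1 * secondForm f x (EuclideanSpace.single 1 1) w := fun w => by
    have h : v = v 0 • EuclideanSpace.single 0 1 + v 1 • EuclideanSpace.single 1 1 := by
      ext i; fin_cases i <;> simp
    conv_lhs => rw [h]
    simp only [secondForm, map_add, map_smul, inner_add_left, real_inner_smul_left]
  have h0 := hlin (EuclideanSpace.single 0 1)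
  have h1 := hlin (EuclideanSpace.single 1 1)
  rw [hz] at h0 h1
  rw [Matrix.det_fin_two] at hdet
  simp only [Matrix.of_apply] at hdet
  ext i
  fin_cases i
  · change v 0 = 0
    refine (mul_eq_zero.1 ?_).resolve_right hdet
    linear_combination
      (-secondForm f x (EuclideanSpace.single 1 1) (EuclideanSpace.single 1 1)) * h0
        + secondForm f x (EuclideanSpace.single 1 1) (EuclideanSpace.single 0 1) * h1
  · change v 1 = 0
    refine (mul_eq_zero.1 ?_).resolve_right hdet
    linear_combination
      (secondForm f x (EuclideanSpace.single 0 1) (EuclideanSpace.single 1 1)) * h0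
        - secondForm f x (EuclideanSpace.single 0 1) (EuclideanSpace.single 0 1) * h1

namespace IsConcavePatch

variable {f : Plane → ℝ} {D : Set Plane} (hf : IsConcavePatch f D)
include hf

theorem fderiv_graphNormal_eq_smul {x : Plane} (hx : x ∈ D) {k : ℝ}
    (hk : ∀ v w, secondForm f x v w = k * firstForm f x v w) (v : Plane) :
    fderiv ℝ (graphNormal f) x v = k • fderiv ℝ (graphMap f) x v := by
  have h := hf.eq_smul_graphNormal hx
    (u := fderiv ℝ (graphNormal f) x v - k • fderiv ℝ (graphMap f) x v) fun w => by
      rw [inner_sub_left, real_inner_smul_left]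
      exact sub_eq_zero.2 (hk v w)
  rw [inner_sub_right, inner_smul_right, hf.inner_graphNormal_fderiv_graphNormal hx,
    hf.inner_graphNormal_fderiv_graphMap hx, mul_zero, sub_zero, zero_smul] at h
  exact sub_eq_zero.1 h

theorem fderiv_graphMap_castSucc {x : Plane} (hx : x ∈ D) (v : Plane) (i : Fin 2) :
    fderiv ℝ (graphMap f) x v i.castSucc = v i := by
  rw [hf.fderiv_graphMap_apply hx]
  fin_cases i <;> rfl

/-- On a totally umbilic ball the principal curvature is constant. Since the differential of the
`i`-th component of the normal is `k dxᵢ`, that component, and then `k`, depends on `xᵢ` only. This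
needs no third derivatives of the height function. -/
theorem umbilic_curvature_const {p : Plane} {R : ℝ} (hB : ball p R ⊆ D) {k : Plane → ℝ}
    (hk : ∀ x ∈ ball p R, ∀ v, fderiv ℝ (graphNormal f) x v = k x • fderiv ℝ (graphMap f) x v)
    {x : Plane} (hx : x ∈ ball p R) : k x = k p := by
  have hcoord : ∀ (i : Fin 2), ∀ z ∈ ball p R, ∀ v,
      fderiv ℝ (graphNormal f) z v i.castSucc = k z * v i := fun i z hz v => by
    rw [hk z hz v, PiLp.smul_apply, hf.fderiv_graphMap_castSucc (hB hz), smul_eq_mul]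
  have hline : ∀ (i : Fin 2), ∀ z (v : Plane) (t : ℝ), z + t • v ∈ ball p R → HasDerivAt
      (fun t : ℝ => graphNormal f (z + t • v) i.castSucc) (k (z + t • v) * v i) t :=
        fun i z v t hz => by
    have hl : HasDerivAt (fun t : ℝ => z + t • v) v t := by
      simpa using ((hasDerivAt_id t).smul_const v).const_add z
    have h := (EuclideanSpace.proj i.castSucc : Space →L[ℝ] ℝ).hasFDerivAt.comp_hasDerivAt t
      ((hf.hasFDerivAt_graphNormal (hB hz)).comp_hasDerivAt t hl)
    rw [← hcoord i _ hz]
    exact h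
  have hconst : ∀ (i : Fin 2), ∀ z ∈ ball p R, ∀ z' ∈ ball p R, z i = z' i →
      graphNormal f z' i.castSucc = graphNormal f z i.castSucc := fun i z hz z' hz' hzz => by
    have hmem : ∀ t ∈ Icc (0 : ℝ) 1, z + t • (z' - z) ∈ ball p R := fun t ht =>
      (convex_ball p R).add_smul_sub_mem hz hz' ht
    have hd : ∀ t ∈ Icc (0 : ℝ) 1,
        HasDerivAt (fun t : ℝ => graphNormal f (z + t • (z' - z)) i.castSucc) 0 t := fun t ht => by
      simpa [hzz] using hline i z (z' - z) t (hmem t ht)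
    have h := constant_of_has_deriv_right_zero
      (fun t ht => (hd t ht).continuousAt.continuousWithinAt)
      (fun t ht => (hd t (Ico_subset_Icc_self ht)).hasDerivWithinAt) 1 (right_mem_Icc.2 zero_le_one)
    simpa using h
  have hkk : ∀ (i : Fin 2), ∀ z ∈ ball p R, ∀ z' ∈ ball p R, z i = z' i → k z' = k z :=
      fun i z hz z' hz' hzz => by
    let e : Plane := EuclideanSpace.single i 1
    have h1 := hline i z e 0 (by simpa using hz)
    have h2 := hline i z' e 0 (by simpa using hz')
    have hev : ∀ z₁ ∈ ball p R, ∀ᶠ t : ℝ in 𝓝 0, z₁ + t • e ∈ ball p R := fun z₁ hz₁ => by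
      have hc : ContinuousAt (fun t : ℝ => z₁ + t • e) 0 := by fun_prop
      exact hc.eventually_mem (by simpa using isOpen_ball.mem_nhds hz₁)
    have h3 := h1.unique (h2.congr_of_eventuallyEq (by
      filter_upwards [hev z hz, hev z' hz'] with t ht ht'
      exact (hconst i _ ht _ ht' (by simp [hzz])).symm))
    simpa [e] using h3.symm
  have hR : 0 < R := dist_nonneg.trans_lt hx
  -- The corner `q` of the rectangle spanned by `p` and `x` is no farther from `p` than `x` is.
  let q : Plane := !₂[x 0, p 1]
  have hq : q ∈ ball p R := by
    refine lt_of_le_of_lt ?_ (mem_ball.1 hx)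
    rw [EuclideanSpace.dist_eq, EuclideanSpace.dist_eq]
    refine Real.sqrt_le_sqrt ?_
    simp [q, Fin.sum_univ_two]
  rw [← hkk 1 p (mem_ball_self hR) q hq rfl, hkk 0 q hq x hx rfl]

/-- If the projection preserves geodesics and some point of the graph has nonzero Gaussian
curvature, then the graph is totally umbilic, with a constant principal curvature: the points with that
curvature form a set that is open and closed. -/
theorem isUmbilic_of_gaussCurvature_ne_zero (hD : IsPreconnected D) {r : ℝ} (hr : 0 < r)
    (hgeo : ProjectionPreservesGeodesics f D r) {p : Plane} (hp : p ∈ D)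
    (hK : gaussCurvature f p ≠ 0) {x : Plane} (hx : x ∈ D) : IsUmbilic f x := by
  have hinjp := injective_fderiv_graphNormal hK
  obtain ⟨c, hc⟩ := hf.isUmbilic_of_injective hr hgeo hp hinjp
  have hcp := hf.fderiv_graphNormal_eq_smul hp hc
  have hc0 : c ≠ 0 := fun h0 => by
    have h : (EuclideanSpace.single 0 1 : Plane) = 0 := hinjp (by rw [hcp, h0, zero_smul, map_zero])
    simp at h
  let A : Set Plane := {x | ∀ v, fderiv ℝ (graphNormal f) x v = c • fderiv ℝ (graphMap f) x v}
  have hopen : ∀ x ∈ D ∩ A, A ∈ 𝓝 x := fun x hx => by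
    have hinj : Function.Injective (fderiv ℝ (graphNormal f) x) := by
      rw [injective_iff_map_eq_zero]
      intro v hv
      rw [hx.2 v, smul_eq_zero] at hv
      rw [← hf.horizontal_fderiv_graphMap hx.1 v, hv.resolve_left hc0, map_zero]
    obtain ⟨R, hR, hRV⟩ := Metric.nhds_basis_ball.mem_iff.1
      (inter_mem ((hf.continuousOn_fderiv_graphNormal.continuousAt
        (hf.isOpen.mem_nhds hx.1)).eventually_mem
          (ContinuousLinearMap.isOpen_injective.mem_nhds hinj)) (hf.isOpen.mem_nhds hx.1))
    have hex : ∀ z, ∃ k : ℝ, z ∈ ball x R →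
        ∀ v, fderiv ℝ (graphNormal f) z v = k • fderiv ℝ (graphMap f) z v := fun z => by
      by_cases hz : z ∈ ball x R
      · obtain ⟨k, hk⟩ := hf.isUmbilic_of_injective hr hgeo (hRV hz).2 (hRV hz).1
        exact ⟨k, fun _ => hf.fderiv_graphNormal_eq_smul (hRV hz).2 hk⟩
      · exact ⟨0, fun h => absurd h hz⟩
    choose k hk using hex
    have hcoord : k x = c := by
      have h1 := hk x (mem_ball_self hR) (EuclideanSpace.single 0 1)
      rw [hx.2] at h1
      have h2 := congrArg (fun z : Space => z (Fin.castSucc (0 : Fin 2))) h1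
      simp only [PiLp.smul_apply, hf.fderiv_graphMap_castSucc hx.1] at h2
      simpa using h2.symm
    refine mem_of_superset (ball_mem_nhds x hR) fun z hz v => ?_
    rw [hk z hz v, hf.umbilic_curvature_const (fun z hz => (hRV hz).2) (fun z hz => hk z hz) hz,
      hcoord]
  have hsub : D ⊆ A := by
    have hcl : ∀ x ∈ D, x ∉ A → Aᶜ ∈ 𝓝 x := fun x hx hxA => by
      obtain ⟨v, hv⟩ := not_forall.1 hxA
      have h1 := (hf.continuousOn_fderiv_graphNormal.clm_apply
        (continuousOn_const (c := v))).continuousAt (hf.isOpen.mem_nhds hx)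
      have h2 := ((hf.continuousOn_fderiv_graphMap.clm_apply
        (continuousOn_const (c := v))).const_smul c).continuousAt (hf.isOpen.mem_nhds hx)
      filter_upwards [(h1.sub h2).eventually_ne (sub_ne_zero.2 hv)] with z hz hzA
      exact hz (sub_eq_zero.2 (hzA v))
    intro x hx
    by_contra hxA
    obtain ⟨z, hzD, hz1, hz2⟩ := hD (interior A) (interior Aᶜ) isOpen_interior isOpen_interior
      (fun z hz => by
        by_cases hzA : z ∈ A
        · exact Or.inl (mem_interior_iff_mem_nhds.2 (hopen z ⟨hz, hzA⟩))
        · exact Or.inr (mem_interior_iff_mem_nhds.2 (hcl z hz hzA)))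
      ⟨p, hp, mem_interior_iff_mem_nhds.2 (hopen p ⟨hp, hcp⟩)⟩
      ⟨x, hx, mem_interior_iff_mem_nhds.2 (hcl x hx hxA)⟩
    exact interior_subset hz2 (interior_subset hz1)
  refine ⟨c, fun v w => ?_⟩
  rw [secondForm, firstForm, hsub hx v, real_inner_smul_left]

end IsConcavePatch

/-! ### The fundamental forms at the origin -/

section PatchHeight

variable {D : Set Plane} {h : Plane → ℝ} {a₁ a₂ : ℝ}

theorem contDiffOn_patchHeight (hh : ContDiffOn ℝ 2 h D) :
    ContDiffOn ℝ 2 (patchHeight a₁ a₂ h) D := by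
  unfold patchHeight
  fun_prop

theorem fderiv_patchHeight {x : Plane} (hh : DifferentiableAt ℝ h x) (w : Plane) :
    fderiv ℝ (patchHeight a₁ a₂ h) x w = -(a₁ * w 0 * x 0 + a₂ * w 1 * x 1) - fderiv ℝ h x w := by
  have h0 : HasFDerivAt (fun y : Plane => y 0) (EuclideanSpace.proj 0 : Plane →L[ℝ] ℝ) x :=
    (EuclideanSpace.proj 0 : Plane →L[ℝ] ℝ).hasFDerivAt
  have h1 : HasFDerivAt (fun y : Plane => y 1) (EuclideanSpace.proj 1 : Plane →L[ℝ] ℝ) x :=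
    (EuclideanSpace.proj 1 : Plane →L[ℝ] ℝ).hasFDerivAt
  have h2 := ((((h0.pow 2).const_mul a₁).add ((h1.pow 2).const_mul a₂)).const_mul
    (-(1 / 2) : ℝ)).sub hh.hasFDerivAt
  rw [HasFDerivAt.fderiv (f := patchHeight a₁ a₂ h) h2]
  simp
  ring

theorem secondForm_patchHeight_zero (hD : IsOpen D) (hD0 : (0 : Plane) ∈ D)
    (hh : ContDiffOn ℝ 2 h D) (hf : IsConcavePatch (patchHeight a₁ a₂ h) D)
    (hh1 : fderiv ℝ h 0 = 0) (hh2 : fderiv ℝ (fderiv ℝ h) 0 = 0) (v w : Plane) :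
    secondForm (patchHeight a₁ a₂ h) 0 v w = a₁ * v 0 * w 0 + a₂ * v 1 * w 1 := by
  have hdiff : ∀ x ∈ D, DifferentiableAt ℝ h x := fun x hx =>
    (hh.contDiffAt (hD.mem_nhds hx)).differentiableAt (by norm_num)
  have hn : graphNormal (patchHeight a₁ a₂ h) 0 2 = 1 := by
    simp [graphNormal, partialD, fderiv_patchHeight (hdiff 0 hD0), hh1]
  have hdd : HasFDerivAt (fderiv ℝ h) (0 : Plane →L[ℝ] Plane →L[ℝ] ℝ) 0 := by
    rw [← hh2]
    exact (((hh.fderiv_of_isOpen hD (m := 1) (by norm_num)).contDiffAt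
      (hD.mem_nhds hD0)).differentiableAt (by norm_num)).hasFDerivAt
  have h0 : HasFDerivAt (fun y : Plane => y 0) (EuclideanSpace.proj 0 : Plane →L[ℝ] ℝ) 0 :=
    (EuclideanSpace.proj 0 : Plane →L[ℝ] ℝ).hasFDerivAt
  have h1 : HasFDerivAt (fun y : Plane => y 1) (EuclideanSpace.proj 1 : Plane →L[ℝ] ℝ) 0 :=
    (EuclideanSpace.proj 1 : Plane →L[ℝ] ℝ).hasFDerivAt
  have h3 := (((h0.const_mul (a₁ * w 0)).add (h1.const_mul (a₂ * w 1))).neg).sub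
    ((ContinuousLinearMap.apply ℝ ℝ w).hasFDerivAt.comp (0 : Plane) hdd)
  have h4 := (ContinuousLinearMap.apply ℝ ℝ w).hasFDerivAt.comp (0 : Plane)
    (hf.hasFDerivAt_fderiv hD0)
  have h5 := DFunLike.congr_fun (h4.unique (h3.congr_of_eventuallyEq (by
    filter_upwards [hD.mem_nhds hD0] with x hx
    exact fderiv_patchHeight (hdiff x hx) w))) v
  simp at h5
  rw [hf.secondForm_eq hD0, hn, h5]
  ring

theorem firstForm_patchHeight_zero (hD : IsOpen D) (hD0 : (0 : Plane) ∈ D)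
    (hh : ContDiffOn ℝ 2 h D) (hf : IsConcavePatch (patchHeight a₁ a₂ h) D)
    (hh1 : fderiv ℝ h 0 = 0) (v w : Plane) :
    firstForm (patchHeight a₁ a₂ h) 0 v w = v 0 * w 0 + v 1 * w 1 := by
  have hdiff : DifferentiableAt ℝ h 0 :=
    (hh.contDiffAt (hD.mem_nhds hD0)).differentiableAt (by norm_num)
  rw [firstForm, hf.fderiv_graphMap_apply hD0, hf.fderiv_graphMap_apply hD0]
  simp [PiLp.inner_apply, Fin.sum_univ_three, fderiv_patchHeight hdiff, hh1]
  ring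

end PatchHeight

theorem mainTheorem1
    (D : Set (EuclideanSpace ℝ (Fin 2))) (hDopen : IsOpen D) (hDconn : IsConnected D)
    (hD0 : (0 : EuclideanSpace ℝ (Fin 2)) ∈ D)
    (h : EuclideanSpace ℝ (Fin 2) → ℝ) (hh : ContDiffOn ℝ 2 h D)
    (hh0 : h 0 = 0) (hh1 : fderiv ℝ h 0 = 0) (hh2 : fderiv ℝ (fderiv ℝ h) 0 = 0)
    (a₁ a₂ : ℝ) (ha₁ : 0 ≤ a₁) (ha₂ : 0 ≤ a₂)
    (hconv : ConcaveOn ℝ (convexHull ℝ D) (patchHeight a₁ a₂ h))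
    (r : ℝ) (hr : 0 < r)
    (hgeo : ProjectionPreservesGeodesics (patchHeight a₁ a₂ h) D r) :
    (a₁ * a₂ = 0 ∧ ∀ x ∈ D, gaussCurvature (patchHeight a₁ a₂ h) x = 0) ∨
      (a₁ = a₂ ∧ ∀ x ∈ D, IsUmbilic (patchHeight a₁ a₂ h) x) := by
  have hf := hconv.isConcavePatch hDopen (contDiffOn_patchHeight hh)
  have hII := secondForm_patchHeight_zero hDopen hD0 hh hf hh1 hh2
  have hI := firstForm_patchHeight_zero hDopen hD0 hh hf hh1
  by_cases hK : ∀ x ∈ D, gaussCurvature (patchHeight a₁ a₂ h) x = 0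
  · refine Or.inl ⟨?_, hK⟩
    have h0 := hK 0 hD0
    simpa [gaussCurvature, Matrix.det_fin_two, hI, hII] using h0
  · push Not at hK
    obtain ⟨p, hp, hKp⟩ := hK
    have humb : ∀ x ∈ D, IsUmbilic (patchHeight a₁ a₂ h) x := fun x hx =>
      hf.isUmbilic_of_gaussCurvature_ne_zero hDconn.isPreconnected hr hgeo hp hKp hx
    refine Or.inr ⟨?_, humb⟩
    obtain ⟨k, hk⟩ := humb 0 hD0
    have h1 := hk (EuclideanSpace.single 0 1) (EuclideanSpace.single 0 1)
    have h2 := hk (EuclideanSpace.single 1 1) (EuclideanSpace.single 1 1)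
    simp [hI, hII] at h1 h2
    rw [h1, h2]
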